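/- Let $n\ge 2$, $k\ge 0$, and let $P_k^+$ be the set of dominant integral weights of $\widehat{\mathfrak{su}}(n)$ of level $k$, i.e. of tuples of Dynkin labels $m=(m_1,\dots,m_n)\in\mathbb Z_{\ge0}^n$ with $\sum_i m_i=k$ ($m_n$ being the label of the affine node). A weight $\hat\lambda\in P_k^+$ with labels $m(\hat\lambda)=(m_1,\dots,m_n)$ is identified with the partition $\lambda=(\lambda_1,\dots,\lambda_{n-1})$, $\lambda_i=m_i+\dots+m_{n-1}$; put $\lambda_n=0$ and $|\lambda|=\sum_i\lambda_i$. Let $\hat\emptyset\in P_k^+$ be the weight of the empty partition. The fusion coefficients are given by the Verlinde formula $$\mathcal N^{(k)\hat\nu}_{\hat\lambda\hat\mu}=\sum_{\hat\sigma\in P_k^+}\frac{S_{\hat\lambda\hat\sigma}S_{\hat\mu\hat\sigma}S^{-1}_{\hat\nu\hat\sigma}}{S_{\hat\emptyset\hat\sigma}},\qquad S_{\hat\lambda\hat\sigma}=\frac{e^{i\pi n(n-1)/4}}{\sqrt{n(k+n)^{n-1}}}\sum_{w\in \mathbb S_n}(-1)^{\ell(w)}e^{-\frac{2\pi i}{k+n}(\sigma+\rho,\,w(\lambda+\rho))},$$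 where $(\lambda+\rho)_i=\lambda_i-\frac{|\lambda|}{n}+\frac{n+1}{2}-i$ for $1\le i\le n$, $(\cdot,\cdot)$ is the standard inner product of $\mathbb R^n$ and $\mathbb S_n$ permutes coordinates. Consider the square lattice on the cylinder with $n-1$ rows and $n$ columns. A lattice configuration assigns a non-negative integer to each edge such that at every vertex the values $a$ (left edge), $b$ (top edge), $c$ (right edge), $d'$ (bottom edge) satisfy $c\le b$ and $d'=a+b-c$, and such that in each row the two outer horizontal edges (left of the first and right of the last column) carry the same value. For $\hat\mu,\hat\nu\in P_k^+$ and $d\in\mathbb Z_{\ge0}$ let $\Gamma^{\hat\mu}_{\hat\nu}(d)$ be the set of lattice configurations in which the outer vertical edges entering the first (top) row carry the values $m_1(\hat\mu),\dots,m_n(\hat\mu)$, those leaving the last (bottom) row carry $m_1(\hat\nu),\dots,m_n(\hat\nu)$, and the values of all outer horizontal edges (left and right, over all rows) add up to $2d$. Then $\Gamma^{\hat\mu}_{\hat\nu}(d)$ is finite and $$|\Gamma_{\hat\nu}^{\hat\mu}(d)|=\sum_{\hat\lambda}\mathcal N^{(k)\hat\nu}_{\hat\lambda\hat\mu}\prod_{s\in\lambda}\frac{n-1+c(s)}{h(s)},$$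 where the sum runs over those $\hat\lambda\in P_k^+$ for which $d=\frac{|\lambda|+|\mu|-|\nu|}{n}+\nu_1-\mu_1$, the product runs over the squares $s=(i,j)$ of the Young diagram of $\lambda$, $c(s)=j-i$ is the content and $h(s)=\lambda_i+\lambda^t_j-i-j+1$ the hook length of $s$. -/

import Mathlib

/-- `P_k^+` for affine `su(n)`: a dominant integral weight of level `k` is given by its Dynkin labels
`m_1, …, m_n`, where the label of the affine node is `m_n`. The index `j : Fin n` stands for
the label `m_{j+1}`. -/
def DominantWeight (n k : ℕ) : Type := {m : Fin n → ℕ // ∑ j, m j = k}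

namespace DominantWeight

variable {n k : ℕ}

instance : DecidableEq (DominantWeight n k) :=
  inferInstanceAs (DecidableEq {m : Fin n → ℕ // ∑ j, m j = k})

instance : Fintype (DominantWeight n k) :=
  Fintype.subtype (Finset.piAntidiag Finset.univ k) (by simp)

/-- The Dynkin labels of a weight. -/
def dynkin (l : DominantWeight n k) : Fin n → ℕ := l.1

/-- The parts of the partition of a weight, `l.part i = λ_{i+1}`: the partition has at most `n - 1`
parts, determined by `λ_i - λ_{i+1} = m_i` for `1 ≤ i ≤ n - 1` (with `λ_n = 0`), that is
`λ_i = m_i + … + m_{n-1}`. -/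
def part (l : DominantWeight n k) (i : ℕ) : ℕ :=
  ∑ j : Fin n with i ≤ j.val ∧ j.val + 1 < n, l.dynkin j

/-- The number `|λ|` of squares of the partition. -/
def size (l : DominantWeight n k) : ℕ := ∑ i ∈ Finset.range n, l.part i

theorem part_anti (l : DominantWeight n k) : Antitone l.part := by
  intro a b hab
  unfold part
  apply Finset.sum_le_sum_of_subset
  intro j hj
  simp only [Finset.mem_filter, Finset.mem_univ, true_and] at hj ⊢
  omega

/-- The Young diagram of the partition: the square `(i, j)` (row `i`, column `j`, counted from `0`)
belongs to it if and only if `j < λ_{i+1}`. -/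
def diagram (l : DominantWeight n k) : YoungDiagram where
  cells := (Finset.range n ×ˢ Finset.range k).filter fun s => s.2 < l.part s.1
  isLowerSet := by
    rintro ⟨a, b⟩ ⟨c, d⟩ ⟨h1, h2⟩ h
    simp only [Finset.coe_filter, Finset.mem_product, Finset.mem_range, Set.mem_ofPred_eq] at h ⊢
    simp only at h1 h2
    have := l.part_anti h1
    omega

/-- The weight `k ω̂_n`, which corresponds to the empty partition. -/
def vacuum (hn : 2 ≤ n) (k : ℕ) : DominantWeight n k :=
  ⟨fun j => if j = (⟨n - 1, by omega⟩ : Fin n) then k else 0, by simp⟩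

/-- The finite weight `λ + ρ` of `su(n)` in the coordinates of `ℝⁿ` (sum zero hyperplane):
`(λ + ρ)_i = λ_i - |λ| / n + (n + 1) / 2 - i` for `1 ≤ i ≤ n`. -/
noncomputable def shifted (l : DominantWeight n k) (i : Fin n) : ℝ :=
  (l.part i.val : ℝ) - (l.size : ℝ) / n + (((n : ℝ) + 1) / 2 - ((i.val : ℝ) + 1))

/-- The modular `S`-matrix of the `su(n)` WZNW model at level `k` (Kac-Peterson formula); the Weyl
group is the symmetric group permuting the coordinates, with `(-1)^{ℓ(w)}` the sign of `w`. -/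
noncomputable def modularS (n k : ℕ) : Matrix (DominantWeight n k) (DominantWeight n k) ℂ :=
  fun l s =>
    Complex.exp (Complex.I * Real.pi * n * ((n : ℂ) - 1) / 4) /
        (Real.sqrt ((n : ℝ) * ((k : ℝ) + n) ^ (n - 1)) : ℂ) *
      ∑ w : Equiv.Perm (Fin n), ((Equiv.Perm.sign w : ℤ) : ℂ) *
        Complex.exp (-(2 * Real.pi * Complex.I / ((k : ℂ) + n)) *
          ((∑ i, s.shifted i * l.shifted (w⁻¹ i) : ℝ) : ℂ))

/-- The fusion coefficient `N_{λ μ}^{(k) ν}`, defined by the Verlinde formula. -/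
noncomputable def fusionCoeff (hn : 2 ≤ n) (l μ ν : DominantWeight n k) : ℂ :=
  ∑ s : DominantWeight n k,
    modularS n k l s * modularS n k μ s * (modularS n k)⁻¹ ν s / modularS n k (vacuum hn k) s

end DominantWeight

/-- The hook length of the square `s` of a Young diagram: arm plus leg plus one. In coordinates
counted from `1` it is `λ_i + λ^t_j - i - j + 1`. -/
def hookLength (Y : YoungDiagram) (s : ℕ × ℕ) : ℤ :=
  (Y.rowLen s.1 : ℤ) + Y.colLen s.2 - ((s.1 : ℤ) + 1) - ((s.2 : ℤ) + 1) + 1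

/-- The content (column minus row) of a square. -/
def content (s : ℕ × ℕ) : ℤ := (s.2 : ℤ) - s.1

/-- The hook-content product `∏_{s ∈ Y} (N + c(s)) / h(s)`. -/
def hookContentProd (N : ℤ) (Y : YoungDiagram) : ℚ :=
  ∏ s ∈ Y.cells, ((N + content s : ℤ) : ℚ) / (hookLength Y s : ℚ)

/-- Statistical variables on the edges of the lattice with `n - 1` rows and `n` columns.
The vertex in row `i` and column `j` has left edge `hor i j.castSucc`, right edge `hor i j.succ`,
top edge `ver i.castSucc j` and bottom edge `ver i.succ j`. -/
structure EdgeLabelling (n : ℕ) where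
  /-- horizontal edges; position `0` and position `n` of a row are its outer edges -/
  hor : Fin (n - 1) → Fin (n + 1) → ℕ
  /-- vertical edges; level `0` and level `n - 1` are the outer ones -/
  ver : Fin (n - 1 + 1) → Fin n → ℕ

/-- A vertex with left edge `a`, top edge `b`, right edge `c` and bottom edge `d` is allowed (has
nonzero Boltzmann weight) if and only if `d = a + b - c` and `b ≥ c`. -/
def VertexAllowed (a b c d : ℕ) : Prop := c + d = a + b ∧ c ≤ b

/-- The lattice configurations on the cylinder whose outer vertical edges carry the Dynkin labels
of `μ` (where the paths enter) and of `ν` (where they leave). -/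
def latticeConfigs {n k : ℕ} (μ ν : DominantWeight n k) : Set (EdgeLabelling n) :=
  {C | (∀ i j, VertexAllowed (C.hor i j.castSucc) (C.ver i.castSucc j)
          (C.hor i j.succ) (C.ver i.succ j)) ∧
    (∀ i, C.hor i 0 = C.hor i (Fin.last n)) ∧
    C.ver 0 = μ.dynkin ∧ C.ver (Fin.last (n - 1)) = ν.dynkin}

/-- The total number of outer horizontal edges of the paths: on both boundaries, in all rows. -/
def EdgeLabelling.outer {n : ℕ} (C : EdgeLabelling n) : ℕ :=
  ∑ i, (C.hor i 0 + C.hor i (Fin.last n))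

/-- The lattice configurations with exactly `2 * d` outer horizontal edges. -/
def latticeConfigsWithOuter {n k : ℕ} (μ ν : DominantWeight n k) (d : ℕ) :
    Set (EdgeLabelling n) :=
  {C ∈ latticeConfigs μ ν | C.outer = 2 * d}

/-! Let `X` mark the horizontal edges. The configurations between `μ` and `ν` on `N = n - 1` rows
are then counted by the `(μ, ν)` entry of the `N`-th power of `rowMatrix`
(`exists_finset_rowConfigs`), and everything rests on diagonalising this matrix.

One row moves at most `m_j` particles from site `j` to the next site. On Weyl numerators, written as
determinants in the torus points `x_i` of a weight `σ`, this is a Pieri rule: the sum over all moves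
is a determinant of geometric sums, which cyclic column operations evaluate
(`prod_mul_sum_det_pow`). So the columns of the S-matrix are eigenvectors, with eigenvalue `(1 - x_0
^ K X ^ K) / ∏ (1 - X x_i)` for `K = k + n` (`eigenDen_mul_sum`). Distinct weights have distinct
eigenvalues, which also makes the S-matrix invertible (`isUnit_modularS_det`).

A matrix diagonalised by `S` is determined by its vacuum row: if that row has entries `a_λ`, the
eigenvalue at `σ` is `∑ a_λ S_λσ / S_∅σ`, and the Verlinde formula turns the matrix into `∑ a_λ N_λ`
(`rowMatrix_pow_eq_sum_fusionCoeff`). For the `N`-th power the vacuum row is explicit. Each row adds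
at most one part to the empty partition, so `N` rows never exceed the `N` available parts; the
configurations are Gelfand–Tsetlin patterns, and their number is the hook-content product
(`rowMatrix_pow_vacuum_eq`).

It remains to pass from all horizontal edges, which `X` counts, to the outer ones. A weighted
particle count changes in a controlled way across each row, so either number determines the other
(`colabelSum_of_mem_rowConfigs`), and coefficients of `X` can be compared. -/

open Polynomial

/-! ### Cyclic column operations and the Pieri rule -/

/-- The cyclically shifted tuple, `j ↦ c_{j-1}`. -/
def cycPred {α : Type*} {N : ℕ} (c : Fin (N + 1) → α) : Fin (N + 1) → α :=
  Fin.cons (c (Fin.last N)) fun j => c j.castSucc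

@[simp] theorem cycPred_zero {α : Type*} {N : ℕ} (c : Fin (N + 1) → α) :
    cycPred c 0 = c (Fin.last N) := rfl

@[simp] theorem cycPred_succ {α : Type*} {N : ℕ} (c : Fin (N + 1) → α) (j : Fin N) :
    cycPred c j.succ = c j.castSucc := rfl

/-- Subtracting from every column a multiple of its cyclic predecessor. -/
theorem det_sub_mul_cyclic {R : Type*} [CommRing R] {N : ℕ}
    (V : Matrix (Fin (N + 1)) (Fin (N + 1)) R) (b : Fin (N + 1) → R) :
    (Matrix.of fun i j => V i j -
      b j * cycPred (fun l => V i l) j).det =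
      (1 - ∏ j, b j) * V.det := by
  -- Adding `b j` times the already treated predecessor, from left to right, leaves column `j` equal
  -- to `V_j - β j V_last` with these partial products. The last column is then `(1 - ∏ b) V_last`,
  -- and it clears the other ones.
  set β : Fin (N + 1) → R := fun j => ∏ i ∈ Finset.Iic j, b i with hβ
  have hβ0 : β 0 = b 0 := by
    have : Finset.Iic (0 : Fin (N + 1)) = {0} := by ext i; simp
    simp [hβ, this]
  have hβs (j : Fin N) : β j.succ = b j.succ * β j.castSucc := by
    have : Finset.Iic j.succ = insert j.succ (Finset.Iic j.castSucc) := by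
      ext i; simp only [Finset.mem_Iic, Finset.mem_insert, Fin.ext_iff, Fin.le_def]; simp; omega
    simp only [hβ, this]
    rw [Finset.prod_insert]
    simp [Fin.le_def]
  have hβl : β (Fin.last N) = ∏ j, b j := by
    have : Finset.Iic (Fin.last N) = Finset.univ := by ext i; simp [Fin.le_last]
    simp [hβ, this]
  have h1 : (Matrix.of fun i j => V i j - β j * V i (Fin.last N)).det =
      (Matrix.of fun i j => V i j -
        b j * cycPred (fun l => V i l) j).det := by
    apply Matrix.det_eq_of_forall_col_eq_smul_add_pred (fun j => b j.succ)
    · intro i; simp [hβ0]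
    · intro i j
      simp [hβs]; ring
  have h2 : (Matrix.of fun i j => V i j - β j * V i (Fin.last N)) =
      ((Matrix.of fun i j => if j = Fin.last N then V i j else V i j - β j * V i (Fin.last N)).updateCol
        (Fin.last N) ((1 - ∏ j, b j) • fun i => V i (Fin.last N))) := by
    ext i j
    by_cases h : j = Fin.last N
    · subst h; simp [hβl]; ring
    · simp [h]
  have h3 : ((Matrix.of fun i j => if j = Fin.last N then V i j else
      V i j - β j * V i (Fin.last N)).updateCol (Fin.last N) (fun i => V i (Fin.last N))).det =
      V.det := by
    rw [← Matrix.det_transpose, ← Matrix.det_transpose V]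
    apply Matrix.det_eq_of_forall_row_eq_smul_add_const
      (fun j => if j = Fin.last N then 0 else - β j) (Fin.last N) (by simp)
    intro j i
    by_cases h : j = Fin.last N
    · subst h; simp
    · simp [h]; ring
  rw [← h1, h2, Matrix.det_updateCol_smul, h3]

/-- The exponents `∑_{i > j} (m_i + 1)` attached to a tuple of Dynkin labels. -/
def tailExp {N : ℕ} (m : Fin (N + 1) → ℕ) (j : Fin (N + 1)) : ℕ :=
  ∑ i ∈ Finset.Ioi j, (m i + 1)

theorem tailExp_last {N : ℕ} (m : Fin (N + 1) → ℕ) : tailExp m (Fin.last N) = 0 := by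
  have : Finset.Ioi (Fin.last N) = ∅ := by ext i; simp [Fin.le_last]
  simp [tailExp, this]

theorem tailExp_castSucc {N : ℕ} (m : Fin (N + 1) → ℕ) (j : Fin N) :
    tailExp m j.castSucc = tailExp m j.succ + m j.succ + 1 := by
  have : Finset.Ioi j.castSucc = insert j.succ (Finset.Ioi j.succ) := by
    ext i; simp only [Finset.mem_Ioi, Finset.mem_insert, Fin.ext_iff, Fin.lt_def]; simp; omega
  rw [tailExp, this, Finset.sum_insert (by simp), tailExp]; ring

theorem tailExp_zero {N : ℕ} (m : Fin (N + 1) → ℕ) :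
    tailExp m 0 + m 0 + 1 = ∑ j, (m j + 1) := by
  have : (Finset.univ : Finset (Fin (N + 1))) = insert 0 (Finset.Ioi 0) := by
    ext i; simp [em]
  rw [this, Finset.sum_insert (by simp), tailExp]; ring

/-- The Pieri rule on the cylinder, in generating function form. -/
theorem prod_mul_sum_det_pow {R : Type*} [CommRing R] {N K : ℕ} (x : Fin (N + 1) → R) (u c : R)
    (m : Fin (N + 1) → ℕ) (hK : ∑ j, (m j + 1) = K) (hx : ∀ i, x i ^ K = c) :
    (∏ i, (1 - u * x i)) *
      ∑ a ∈ Fintype.piFinset fun j => Finset.range (m j + 1),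
        u ^ (∑ j, a j) * (Matrix.of fun i j => x i ^ (tailExp m j + a j)).det =
      (1 - c * u ^ K) * (Matrix.of fun i j => x i ^ tailExp m j).det := by
  -- Multilinearity in the columns: the sum over all `a` is one determinant of geometric sums.
  have h1 : ∑ a ∈ Fintype.piFinset fun j => Finset.range (m j + 1),
        u ^ (∑ j, a j) * (Matrix.of fun i j => x i ^ (tailExp m j + a j)).det =
      (Matrix.of fun i j => ∑ a ∈ Finset.range (m j + 1), u ^ a * x i ^ (tailExp m j + a)).det := by
    rw [← Matrix.det_transpose]
    have := (Matrix.detRowAlternating (n := Fin (N + 1)) (R := R)).toMultilinearMap.map_sum_finset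
      (fun j a => u ^ a • fun i => x i ^ (tailExp m j + a)) (fun j => Finset.range (m j + 1))
    have e : (Matrix.of fun i j =>
        ∑ a ∈ Finset.range (m j + 1), u ^ a * x i ^ (tailExp m j + a)).transpose =
        fun j => ∑ a ∈ Finset.range (m j + 1), u ^ a • fun i => x i ^ (tailExp m j + a) := by
      ext j i; simp [Finset.sum_apply]
    rw [e]
    refine Eq.trans ?_ this.symm
    refine Finset.sum_congr rfl fun a _ => ?_
    rw [MultilinearMap.map_smul_univ, smul_eq_mul, Finset.prod_pow_eq_pow_sum]
    congr 1
    exact (Matrix.det_transpose _).symm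
  rw [h1, ← Matrix.det_mul_column]
  -- The row factors `1 - u * x i` telescope the geometric sums, and `tailExp m j + m j + 1` is the
  -- exponent of the preceding column. For `j = 0` it is `K`, so the last column (exponent `0`)
  -- comes back with the factor `x i ^ K = c`; hence the `Fin.cons c`.
  have h2 := det_sub_mul_cyclic (Matrix.of fun i j => x i ^ tailExp m j)
    (fun j => u ^ (m j + 1) * (Fin.cons c fun _ => 1 : Fin (N + 1) → R) j)
  rw [Finset.prod_mul_distrib, Finset.prod_pow_eq_pow_sum, hK, Fin.prod_univ_succ] at h2
  simp only [Fin.cons_zero, Fin.cons_succ, Finset.prod_const_one, mul_one] at h2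
  rw [mul_comm c, ← h2]
  congr 1
  ext i j
  simp only [Matrix.of_apply]
  have hg : (1 - u * x i) * ∑ a ∈ Finset.range (m j + 1), u ^ a * x i ^ (tailExp m j + a) =
      x i ^ tailExp m j - u ^ (m j + 1) * x i ^ (tailExp m j + m j + 1) := by
    have : ∑ a ∈ Finset.range (m j + 1), u ^ a * x i ^ (tailExp m j + a) =
        x i ^ tailExp m j * ∑ a ∈ Finset.range (m j + 1), (u * x i) ^ a := by
      rw [Finset.mul_sum]
      exact Finset.sum_congr rfl fun a _ => by ring
    rw [this, mul_left_comm, mul_neg_geom_sum]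
    ring
  rw [hg]
  congr 1
  refine Fin.cases ?_ (fun j => ?_) j
  · simp only [Fin.cons_zero, cycPred_zero]
    rw [tailExp_zero, hK, hx, tailExp_last]; ring
  · simp only [Fin.cons_succ, cycPred_succ]
    rw [tailExp_castSucc]; ring

/-! ### Weights, points of the torus and the S-matrix -/

namespace DominantWeight

theorem sum_dynkin {n k : ℕ} (l : DominantWeight n k) : ∑ j, l.dynkin j = k := l.2

theorem dynkin_injective {n k : ℕ} :
    Function.Injective (dynkin : DominantWeight n k → Fin n → ℕ) :=
  Subtype.val_injective

variable {N k : ℕ}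

theorem part_eq_add {n : ℕ} (l : DominantWeight n k) (j : ℕ) (hj : j + 1 < n) :
    l.part j = l.dynkin ⟨j, by omega⟩ + l.part (j + 1) := by
  have : (Finset.univ.filter fun i : Fin n => j ≤ i.val ∧ i.val + 1 < n) =
      insert ⟨j, by omega⟩ (Finset.univ.filter fun i : Fin n => j + 1 ≤ i.val ∧ i.val + 1 < n) := by
    ext i; simp [Fin.ext_iff]; omega
  rw [part, this, Finset.sum_insert (by simp), part]

theorem part_eq_zero {n : ℕ} (l : DominantWeight n k) (j : ℕ) (hj : n ≤ j + 1) :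
    l.part j = 0 := by
  rw [part, Finset.filter_false_of_mem, Finset.sum_empty]
  intro i _; omega

theorem part_zero_add (l : DominantWeight (N + 1) k) :
    l.part 0 + l.dynkin (Fin.last N) = k := by
  refine Eq.trans ?_ l.sum_dynkin
  rw [Fin.sum_univ_castSucc, part]
  congr 1
  rw [Finset.sum_filter, Fin.sum_univ_castSucc]
  simp

theorem part_le {n : ℕ} (l : DominantWeight n k) (j : ℕ) : l.part j ≤ k := by
  refine le_of_le_of_eq ?_ l.sum_dynkin
  exact Finset.sum_le_sum_of_subset (Finset.filter_subset _ _)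

theorem tailExp_dynkin (l : DominantWeight (N + 1) k) (j : Fin N) :
    tailExp l.dynkin j.castSucc = l.part (j + 1) + l.dynkin (Fin.last N) + (N - j) := by
  rw [tailExp, Finset.sum_add_distrib, Finset.sum_const, smul_eq_mul, mul_one, Fin.card_Ioi,
    Fin.val_castSucc]
  have : Finset.Ioi j.castSucc = insert (Fin.last N)
      (Finset.univ.filter fun i : Fin (N + 1) => j.val + 1 ≤ i.val ∧ i.val + 1 < N + 1) := by
    ext i; simp [Fin.ext_iff, Fin.lt_def]; omega
  rw [this, Finset.sum_insert (by simp), part]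
  have := j.2
  omega

/-- The additive constant does not depend on `j`, so in a determinant it splits off as a factor of
each row. -/
theorem shifted_succ (l : DominantWeight (N + 1) k) (j : Fin N) :
    l.shifted j.succ = tailExp l.dynkin j.castSucc + (l.shifted 0 - (k + (N + 1 : ℕ))) := by
  have h := l.part_zero_add
  have hj := j.2
  have h' : (l.part 0 : ℝ) + l.dynkin (Fin.last N) = k := by exact_mod_cast h
  rw [tailExp_dynkin]
  push_cast [Nat.cast_sub hj.le]
  simp only [shifted, Fin.val_succ, Fin.val_zero]
  push_cast
  linarith

theorem sum_shifted (l : DominantWeight (N + 1) k) : ∑ i, l.shifted i = 0 := by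
  simp only [shifted]
  rw [Finset.sum_add_distrib, Finset.sum_sub_distrib, Finset.sum_sub_distrib]
  have h1 : ∑ i : Fin (N + 1), (l.part i.val : ℝ) = l.size := by
    rw [size, ← Fin.sum_univ_eq_sum_range]; push_cast; rfl
  have h2 (N : ℕ) : ∑ i : Fin (N + 1), ((i.val : ℝ) + 1) = (N + 1) * (N + 2) / 2 := by
    rw [Fin.sum_univ_eq_sum_range (fun i => (i : ℝ) + 1)]
    induction N with
    | zero => norm_num
    | succ M ih => rw [Finset.sum_range_succ, ih]; push_cast; ring
  rw [h1, h2]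
  have : ((N : ℝ) + 1) ≠ 0 := by positivity
  simp only [Finset.sum_const, Finset.card_univ, Fintype.card_fin, nsmul_eq_mul]
  push_cast
  field_simp
  ring

theorem shifted_strictAnti {n : ℕ} (l : DominantWeight n k) : StrictAnti l.shifted := by
  intro i j h
  have h1 : (l.part j : ℝ) ≤ l.part i := by exact_mod_cast l.part_anti (Fin.le_def.1 h.le)
  have h2 : (i.val : ℝ) < j.val := by exact_mod_cast h
  simp only [shifted]; linarith

/-- The alcove condition. It keeps the coordinates distinct modulo `k + n`, which is all that
`phase` sees. -/
theorem shifted_sub_lt {n : ℕ} (l : DominantWeight n k) (i j : Fin n) :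
    l.shifted i - l.shifted j < k + n := by
  have h1 : (l.part i : ℝ) ≤ k := by exact_mod_cast l.part_le i
  have h2 : (0 : ℝ) ≤ l.part j := by positivity
  have h3 : (j.val : ℝ) < n := by exact_mod_cast j.2
  have h4 : (0 : ℝ) ≤ i.val := by positivity
  simp only [shifted]; linarith

theorem eq_of_shifted_eq (l s : DominantWeight (N + 1) k) (h : l.shifted = s.shifted) : l = s := by
  have hs : l.part (Fin.last N) = s.part (Fin.last N) := by
    rw [part_eq_zero _ _ (by simp), part_eq_zero _ _ (by simp)]
  have hp (i : Fin (N + 1)) : l.part i = s.part i := by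
    have h1 := congrFun h i
    have h2 := congrFun h (Fin.last N)
    simp only [shifted, hs] at h1 h2
    have : (l.part i : ℝ) = s.part i := by linarith
    exact_mod_cast this
  apply dynkin_injective
  funext i
  refine Fin.lastCases ?_ (fun j => ?_) i
  · have h1 := l.part_zero_add
    have h2 := s.part_zero_add
    have h3 := hp 0
    simp only [Fin.val_zero] at h3
    omega
  · have h1 := l.part_eq_add j (by omega)
    have h2 := s.part_eq_add j (by omega)
    have h3 := hp j.castSucc
    have h4 := hp j.succ
    simp only [Fin.val_castSucc, Fin.val_succ] at h3 h4
    change l.dynkin ⟨j, _⟩ = s.dynkin ⟨j, _⟩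
    omega

/-- The exponential `e^{-2π i z / (k + n)}`. -/
noncomputable def phase (n k : ℕ) (z : ℝ) : ℂ :=
  Complex.exp (-(2 * Real.pi * Complex.I / ((k : ℂ) + n)) * z)

theorem phase_add (n : ℕ) (a b : ℝ) : phase n k (a + b) = phase n k a * phase n k b := by
  simp only [phase]; rw [← Complex.exp_add]; push_cast; ring_nf

theorem phase_zero (n : ℕ) : phase n k 0 = 1 := by simp [phase]

theorem phase_ne_zero (n : ℕ) (a : ℝ) : phase n k a ≠ 0 := Complex.exp_ne_zero _

theorem phase_sum {ι : Type*} (n : ℕ) (s : Finset ι) (f : ι → ℝ) :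
    phase n k (∑ i ∈ s, f i) = ∏ i ∈ s, phase n k (f i) := by
  classical
  induction s using Finset.induction_on with
  | empty => simp [phase_zero]
  | insert a s ha ih => rw [Finset.sum_insert ha, Finset.prod_insert ha, phase_add, ih]

theorem phase_mul_nat (n : ℕ) (a : ℝ) (m : ℕ) : phase n k (a * m) = phase n k a ^ m := by
  simp only [phase]; rw [← Complex.exp_nat_mul]; push_cast; ring_nf

theorem phase_eq_iff (n : ℕ) (hn : 0 < k + n) (a b : ℝ) :
    phase n k a = phase n k b ↔ ∃ z : ℤ, a = b + (k + n) * z := by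
  have hK : ((k : ℂ) + n) ≠ 0 := by exact_mod_cast hn.ne'
  have hpi : (Real.pi : ℂ) ≠ 0 := by exact_mod_cast Real.pi_ne_zero
  rw [phase, phase, Complex.exp_eq_exp_iff_exists_int]
  constructor
  · rintro ⟨z, hz⟩
    refine ⟨-z, ?_⟩
    have : (a : ℂ) = b + (k + n) * ((-z : ℤ) : ℂ) := by
      field_simp at hz
      push_cast
      linear_combination (-1 : ℂ) * hz
    exact_mod_cast this
  · rintro ⟨z, hz⟩
    refine ⟨-z, ?_⟩
    rw [hz]; push_cast; field_simp; ring

/-- The point `e^{-2π i (σ + ρ) / (k + n)}` of the torus. -/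
noncomputable def torusPoint {n : ℕ} (s : DominantWeight n k) (i : Fin n) : ℂ :=
  phase n k (s.shifted i)

theorem prod_torusPoint (s : DominantWeight (N + 1) k) : ∏ i, s.torusPoint i = 1 := by
  simp only [torusPoint]; rw [← phase_sum, sum_shifted, phase_zero]

theorem torusPoint_injective {n : ℕ} (s : DominantWeight n k) :
    Function.Injective s.torusPoint := by
  intro i j h
  have hpos : 0 < k + n := by have := i.2; omega
  have hK : (0 : ℝ) < k + n := by exact_mod_cast hpos
  obtain ⟨z, hz⟩ := (phase_eq_iff n hpos _ _).1 h
  have h1 := s.shifted_sub_lt i j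
  have h2 := s.shifted_sub_lt j i
  have h3 : (z : ℝ) < 1 := by nlinarith
  have h4 : (-1 : ℝ) < z := by nlinarith
  have h5 : z = 0 := by
    have : z < 1 := by exact_mod_cast h3
    have : -1 < z := by exact_mod_cast h4
    omega
  rw [h5] at hz
  exact s.shifted_strictAnti.injective (by simpa using hz)

/-- The coordinates of `s.shifted` differ by integers, so the `(k + n)`-th power does not depend on
`i`. -/
theorem torusPoint_pow (s : DominantWeight (N + 1) k) (i : Fin (N + 1)) :
    s.torusPoint i ^ (k + (N + 1)) = phase (N + 1) k (s.shifted 0 * ((k : ℝ) + (N + 1 : ℕ))) := by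
  rw [torusPoint, ← phase_mul_nat, phase_eq_iff _ (by omega)]
  refine ⟨(s.part i : ℤ) - s.part 0 - i, ?_⟩
  simp only [shifted, Fin.val_zero]
  push_cast
  ring

theorem torusPoint_pow_eq (s : DominantWeight (N + 1) k) (i : Fin (N + 1)) :
    s.torusPoint i ^ (k + (N + 1)) = s.torusPoint 0 ^ (k + (N + 1)) := by
  rw [torusPoint_pow, torusPoint_pow]

/-- The numerator of the Weyl character formula at a point of the torus. -/
noncomputable def weylNumerator {n : ℕ} (l s : DominantWeight n k) : ℂ :=
  (Matrix.of fun i j => phase n k (s.shifted i * l.shifted j)).det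

/-- The normalization of the modular S-matrix. -/
noncomputable def modularNorm (n k : ℕ) : ℂ :=
  Complex.exp (Complex.I * Real.pi * n * ((n : ℂ) - 1) / 4) /
    (Real.sqrt ((n : ℝ) * ((k : ℝ) + n) ^ (n - 1)) : ℂ)

theorem modularNorm_ne_zero : modularNorm (N + 1) k ≠ 0 := by
  refine div_ne_zero (Complex.exp_ne_zero _) ?_
  have : 0 < Real.sqrt (((N + 1 : ℕ) : ℝ) * ((k : ℝ) + (N + 1 : ℕ)) ^ (N + 1 - 1)) :=
    Real.sqrt_pos.2 (by positivity)
  exact_mod_cast this.ne'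

theorem modularS_apply {n : ℕ} (l s : DominantWeight n k) :
    modularS n k l s = modularNorm n k * weylNumerator l s := by
  rw [modularS, modularNorm, weylNumerator, Matrix.det_apply']
  congr 1
  refine Finset.sum_congr rfl fun w _ => ?_
  simp only [Matrix.of_apply]
  rw [← phase_sum, phase, ← Equiv.sum_comp w (fun i => s.shifted i * l.shifted (w⁻¹ i))]
  simp

theorem weylNumerator_comm {n : ℕ} (l s : DominantWeight n k) :
    weylNumerator l s = weylNumerator s l := by
  rw [weylNumerator, ← Matrix.det_transpose, weylNumerator]
  congr 1
  ext i j
  simp [mul_comm]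

theorem modularS_transpose (n k : ℕ) : (modularS n k).transpose = modularS n k := by
  ext l s
  rw [Matrix.transpose_apply, modularS_apply, modularS_apply, weylNumerator_comm]

/-- The constant relating the Weyl numerator to the determinant with exponents `tailExp`. -/
noncomputable def tailConst (s : DominantWeight (N + 1) k) : ℂ :=
  ((Equiv.Perm.sign (finRotate (N + 1)) : ℤ) : ℂ) * s.torusPoint 0 ^ (k + (N + 1))

/-- Rotate the columns by one, so that `shifted 0` comes last. Up to the common shift `a` the
exponents are then `tailExp`, except for an extra `k + n` in the last column, which yields a
constant by `torusPoint_pow_eq`. The shift contributes nothing, because the coordinates of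
`s.shifted` sum to zero. -/
theorem weylNumerator_eq (l s : DominantWeight (N + 1) k) :
    weylNumerator l s =
      tailConst s * (Matrix.of fun i j => s.torusPoint i ^ tailExp l.dynkin j).det := by
  set a : ℝ := l.shifted 0 - (k + (N + 1 : ℕ)) with ha
  have h1 : (Matrix.of fun i j => phase (N + 1) k (s.shifted i * l.shifted j)).submatrix id
      (finRotate (N + 1)) = Matrix.of fun i j => phase (N + 1) k (s.shifted i * a) *
        (Matrix.of fun i j => (Fin.lastCases (s.torusPoint 0 ^ (k + (N + 1))) (fun _ => 1) j : ℂ) *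
          (Matrix.of fun i j => s.torusPoint i ^ tailExp l.dynkin j) i j) i j := by
    ext i j
    simp only [Matrix.submatrix_apply, Matrix.of_apply, id]
    refine Fin.lastCases ?_ (fun j => ?_) j
    · rw [finRotate_last, Fin.lastCases_last, tailExp_last, ← torusPoint_pow_eq s i, torusPoint,
        ← phase_mul_nat, pow_zero, mul_one, ← phase_add, ha]
      congr 1
      push_cast; ring
    · rw [finRotate_of_lt (by simp), Fin.lastCases_castSucc]
      have : (⟨(j.castSucc : Fin (N + 1)).val + 1, by simp⟩ : Fin (N + 1)) = j.succ := rfl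
      rw [this, shifted_succ, ← ha, one_mul, torusPoint, ← phase_mul_nat, ← phase_add]
      congr 1; ring
  have h2 := congrArg Matrix.det h1
  rw [Matrix.det_permute', Matrix.det_mul_column, Matrix.det_mul_row, ← phase_sum,
    ← Finset.sum_mul, sum_shifted, zero_mul, phase_zero, one_mul, Fin.prod_univ_castSucc] at h2
  simp only [Fin.lastCases_last, Fin.lastCases_castSucc, Finset.prod_const_one, one_mul] at h2
  rw [tailConst, mul_assoc, ← h2, ← mul_assoc, ← Int.cast_mul, Int.units_coe_mul_self, Int.cast_one,
    one_mul, weylNumerator]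

theorem part_vacuum {n : ℕ} (hn : 2 ≤ n) (j : ℕ) : (vacuum hn k).part j = 0 := by
  refine Finset.sum_eq_zero fun i hi => ?_
  simp only [Finset.mem_filter, Finset.mem_univ, true_and] at hi
  simp only [dynkin, vacuum]
  rw [if_neg]
  intro h
  rw [h] at hi
  simp only at hi
  omega

/-- For the vacuum the exponents descend in steps of one, so up to row factors this is a Vandermonde
determinant in the distinct inverse torus points. -/
theorem weylNumerator_vacuum_ne_zero {n : ℕ} (hn : 2 ≤ n) (s : DominantWeight n k) :
    weylNumerator (vacuum hn k) s ≠ 0 := by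
  obtain ⟨N, rfl⟩ : ∃ N, n = N + 1 := ⟨n - 1, by omega⟩
  have h : (Matrix.of fun i j => phase (N + 1) k (s.shifted i * (vacuum hn k).shifted j)) =
      Matrix.of fun i j => phase (N + 1) k (s.shifted i * (vacuum hn k).shifted 0) *
        Matrix.vandermonde (fun i => (s.torusPoint i)⁻¹) i j := by
    ext i j
    simp only [Matrix.of_apply, Matrix.vandermonde_apply]
    rw [inv_pow, torusPoint, eq_mul_inv_iff_mul_eq₀ (pow_ne_zero _ (phase_ne_zero _ _)),
      ← phase_mul_nat, ← phase_add]
    congr 1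
    simp only [shifted, part_vacuum, Fin.val_zero]
    push_cast
    ring
  rw [weylNumerator, h, Matrix.det_mul_column]
  refine mul_ne_zero (Finset.prod_ne_zero_iff.2 fun i _ => phase_ne_zero _ _) ?_
  rw [Matrix.det_vandermonde_ne_zero_iff]
  exact fun i j hij => s.torusPoint_injective (inv_injective hij)

theorem modularS_vacuum_ne_zero {n : ℕ} (hn : 2 ≤ n) (s : DominantWeight n k) :
    modularS n k (vacuum hn k) s ≠ 0 := by
  rw [modularS_apply]
  refine mul_ne_zero ?_ (weylNumerator_vacuum_ne_zero hn s)
  obtain ⟨N, rfl⟩ : ∃ N, n = N + 1 := ⟨n - 1, by omega⟩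
  exact modularNorm_ne_zero

/-- A weight is determined by the points of the torus attached to it. -/
theorem eq_of_torusPoint (l s : DominantWeight (N + 1) k)
    (h : ∀ i, ∃ j, l.torusPoint i = s.torusPoint j) : l = s := by
  choose w hw using h
  have hinj : Function.Injective w := fun i j hij =>
    l.torusPoint_injective (by rw [hw, hw, hij])
  have hbij : Function.Bijective w := Finite.injective_iff_bijective.1 hinj
  have hK : (0 : ℝ) < k + (N + 1 : ℕ) := by positivity
  choose z hz using fun i => (phase_eq_iff (N + 1) (by omega) _ _).1 (hw i)
  -- The shifts `z i` vanish: their sum is zero because both weights have coordinate sum zero, and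
  -- the alcove condition forces any two of them to differ by at most one.
  have hsum : ∑ i, z i = 0 := by
    have h1 : ∑ i, l.shifted i = ∑ i, s.shifted (w i) + (k + (N + 1 : ℕ)) * ∑ i, (z i : ℝ) := by
      rw [Finset.mul_sum, ← Finset.sum_add_distrib]
      exact Finset.sum_congr rfl fun i _ => hz i
    rw [hbij.sum_comp s.shifted, sum_shifted, sum_shifted, zero_add] at h1
    have h2 := (mul_eq_zero.1 h1.symm).resolve_left hK.ne'
    exact_mod_cast h2
  have hclose (i j : Fin (N + 1)) : z i ≤ z j + 1 := by
    have h1 := l.shifted_sub_lt i j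
    have h2 := s.shifted_sub_lt (w j) (w i)
    have h3 : (z i : ℝ) - z j < 2 := by
      have := hz i
      have := hz j
      nlinarith
    have : z i - z j < 2 := by exact_mod_cast h3
    omega
  have hz0 (i : Fin (N + 1)) : z i = 0 := by
    have hi := Finset.mem_univ i
    rcases lt_trichotomy (z i) 0 with h | h | h
    · have h1 : ∀ j ∈ Finset.univ, 0 ≤ - z j := fun j _ => by have := hclose j i; omega
      have h2 := (Finset.sum_eq_zero_iff_of_nonneg h1).1 (by simp [hsum]) i hi
      omega
    · exact h
    · have h1 : ∀ j ∈ Finset.univ, 0 ≤ z j := fun j _ => by have := hclose i j; omega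
      exact (Finset.sum_eq_zero_iff_of_nonneg h1).1 hsum i hi
  apply eq_of_shifted_eq
  have hcomp : l.shifted = s.shifted ∘ w := by
    funext i; rw [hz i, hz0 i]; simp
  have h1 : StrictMono fun i => - l.shifted i := fun i j h => neg_lt_neg (l.shifted_strictAnti h)
  have h2 : StrictMono fun i => - s.shifted i := fun i j h => neg_lt_neg (s.shifted_strictAnti h)
  -- Both sequences are strictly decreasing with the same range, so the permutation `w` is trivial.
  have h3 := (StrictMono.range_inj h1 h2).1 (by
    rw [hcomp]
    exact hbij.surjective.range_comp (fun i => - s.shifted i))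
  funext i
  exact neg_injective (congrFun h3 i)

end DominantWeight

/-! ### The row-to-row transfer matrix and its eigenvectors -/

theorem sum_cycPred {M : Type*} [AddCommMonoid M] {N : ℕ} (c : Fin (N + 1) → M) :
    ∑ j, cycPred c j = ∑ j, c j := by
  rw [Fin.sum_univ_succ, Fin.sum_univ_castSucc c]
  simp [add_comm]

/-- Conservation at the vertices to the right of `j` telescopes. The discrepancy `c (Fin.last N)` is
the same for all `j`, which is what `det_torusPoint_of_row` needs. -/
theorem tailExp_add_of_row {N : ℕ} {a b c : Fin (N + 1) → ℕ}
    (h : ∀ j, b j + c j = a j + cycPred c j) (j : Fin (N + 1)) :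
    tailExp b j + c (Fin.last N) = tailExp a j + c j := by
  induction j using Fin.reverseInduction with
  | last => rw [tailExp_last, tailExp_last]
  | cast j ih =>
    have := h j.succ
    rw [cycPred_succ] at this
    rw [tailExp_castSucc, tailExp_castSucc]
    omega

namespace DominantWeight

variable {N k : ℕ}

/-- The admissible values of the horizontal edges (to the right of each vertex) in a row of the
cylinder with the labels of `μ` on top and those of `ν` at the bottom. -/
def rowSet (μ ν : DominantWeight (N + 1) k) : Finset (Fin (N + 1) → ℕ) :=
  (Fintype.piFinset fun j => Finset.range (μ.dynkin j + 1)).filter fun c =>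
    ∀ j, ν.dynkin j + c j = μ.dynkin j + cycPred c j

theorem mem_rowSet {μ ν : DominantWeight (N + 1) k} {c : Fin (N + 1) → ℕ} :
    c ∈ rowSet μ ν ↔
      (∀ j, c j ≤ μ.dynkin j) ∧ ∀ j, ν.dynkin j + c j = μ.dynkin j + cycPred c j := by
  simp [rowSet]

/-- The row-to-row transfer matrix; the exponent counts the occupied horizontal edges. -/
noncomputable def rowMatrix (N k : ℕ) :
    Matrix (DominantWeight (N + 1) k) (DominantWeight (N + 1) k) ℂ[X] :=
  fun μ ν => ∑ c ∈ rowSet μ ν, X ^ ∑ j, c j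

/-- The weight obtained from `μ` by moving `c j` particles from the site `j` to the next one. -/
def hop (μ : DominantWeight (N + 1) k) (c : Fin (N + 1) → ℕ) (hc : ∀ j, c j ≤ μ.dynkin j) :
    DominantWeight (N + 1) k :=
  ⟨fun j => μ.dynkin j - c j + cycPred c j, by
    rw [Finset.sum_add_distrib, sum_cycPred, ← Finset.sum_add_distrib]
    refine Eq.trans ?_ μ.sum_dynkin
    exact Finset.sum_congr rfl fun j _ => Nat.sub_add_cancel (hc j)⟩

theorem eq_hop_iff {μ ν : DominantWeight (N + 1) k} {c : Fin (N + 1) → ℕ}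
    (hc : ∀ j, c j ≤ μ.dynkin j) :
    ν = hop μ c hc ↔ ∀ j, ν.dynkin j + c j = μ.dynkin j + cycPred c j := by
  have key : ν = hop μ c hc ↔ ∀ j, ν.dynkin j = μ.dynkin j - c j + cycPred c j :=
    ⟨fun h j => by rw [h]; rfl, fun h => dynkin_injective (funext h)⟩
  rw [key]
  refine forall_congr' fun j => ?_
  have := hc j
  omega

/-- Denominator of the eigenvalue of the row-to-row transfer matrix. -/
noncomputable def eigenDen (s : DominantWeight (N + 1) k) : ℂ[X] :=
  ∏ i, (1 - X * C (s.torusPoint i))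

/-- Numerator of the eigenvalue of the row-to-row transfer matrix. -/
noncomputable def eigenNum (s : DominantWeight (N + 1) k) : ℂ[X] :=
  1 - C (s.torusPoint 0 ^ (k + (N + 1))) * X ^ (k + (N + 1))

theorem eigenDen_coeff_zero (s : DominantWeight (N + 1) k) : (eigenDen s).coeff 0 = 1 := by
  simp [eigenDen, coeff_zero_eq_eval_zero, eval_prod]

theorem eigenDen_ne_zero (s : DominantWeight (N + 1) k) : eigenDen s ≠ 0 := by
  intro h
  have := eigenDen_coeff_zero s
  simp [h] at this

/-- Identifies a term of the Pieri rule with the numerator of the weight below the row: the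
exponents differ by a constant, and `∏ x_i = 1`. -/
theorem det_torusPoint_of_row {μ ν s : DominantWeight (N + 1) k} {c : Fin (N + 1) → ℕ}
    (h : ∀ j, ν.dynkin j + c j = μ.dynkin j + cycPred c j) :
    (Matrix.of fun i j => C (s.torusPoint i) ^ (tailExp μ.dynkin j + c j)).det =
      C (Matrix.of fun i j => s.torusPoint i ^ tailExp ν.dynkin j).det := by
  have h1 : (Matrix.of fun i j => C (s.torusPoint i) ^ (tailExp μ.dynkin j + c j)) =
      C.mapMatrix (Matrix.of fun i j => s.torusPoint i ^ c (Fin.last N) *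
        (Matrix.of fun i j => s.torusPoint i ^ tailExp ν.dynkin j) i j) := by
    ext1 i j
    simp only [Matrix.of_apply, RingHom.mapMatrix_apply, Matrix.map_apply]
    rw [← tailExp_add_of_row h j, ← C_pow, pow_add, mul_comm]
  rw [h1, ← RingHom.map_det, Matrix.det_mul_column, Finset.prod_pow, prod_torusPoint, one_pow,
    one_mul]

/-- The columns of the modular S-matrix are eigenvectors of the row-to-row transfer matrix. -/
theorem eigenDen_mul_sum (μ s : DominantWeight (N + 1) k) :
    eigenDen s * ∑ ν, rowMatrix N k μ ν * C (modularS (N + 1) k ν s) =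
      eigenNum s * C (modularS (N + 1) k μ s) := by
  have h1 := prod_mul_sum_det_pow (fun i => C (s.torusPoint i)) X
    (C (s.torusPoint 0 ^ (k + (N + 1)))) μ.dynkin (K := k + (N + 1))
    (by rw [Finset.sum_add_distrib, sum_dynkin]; simp)
    (fun i => by rw [← C_pow, torusPoint_pow_eq])
  have h2 : ∑ ν, rowMatrix N k μ ν *
        C (Matrix.of fun i j => s.torusPoint i ^ tailExp ν.dynkin j).det =
      ∑ a ∈ Fintype.piFinset fun j => Finset.range (μ.dynkin j + 1), X ^ (∑ j, a j) *
        (Matrix.of fun i j => C (s.torusPoint i) ^ (tailExp μ.dynkin j + a j)).det := by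
    simp only [rowMatrix, Finset.sum_mul, rowSet, Finset.sum_filter]
    rw [Finset.sum_comm]
    refine Finset.sum_congr rfl fun a ha => ?_
    have ha' : ∀ j, a j ≤ μ.dynkin j := by simpa [Nat.lt_succ_iff] using ha
    rw [Finset.sum_eq_single (hop μ a ha')]
    · have h := (eq_hop_iff ha').1 rfl
      rw [if_pos h, det_torusPoint_of_row h]
    · intro ν _ hν
      rw [if_neg fun h => hν ((eq_hop_iff ha').2 h), zero_mul]
    · simp
  have h3 (ν : DominantWeight (N + 1) k) : C (modularS (N + 1) k ν s) =
      C (modularNorm (N + 1) k * tailConst s) *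
        C (Matrix.of fun i j => s.torusPoint i ^ tailExp ν.dynkin j).det := by
    rw [modularS_apply, weylNumerator_eq, ← C_mul, mul_assoc]
  have h4 : (Matrix.of fun i j => C (s.torusPoint i) ^ tailExp μ.dynkin j).det =
      C (Matrix.of fun i j => s.torusPoint i ^ tailExp μ.dynkin j).det := by
    have := det_torusPoint_of_row (μ := μ) (ν := μ) (s := s) (c := 0) (fun j => by
      refine Fin.cases ?_ (fun j => ?_) j <;> simp)
    simpa using this
  rw [← h2, h4] at h1
  simp only [h3, mul_left_comm _ (C (modularNorm (N + 1) k * tailConst s))]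
  rw [← Finset.mul_sum, mul_left_comm, eigenDen, h1, eigenNum]

theorem eigenDen_mul_rowMatrix_pow (R : ℕ) (μ s : DominantWeight (N + 1) k) :
    eigenDen s ^ R * ∑ ν, (rowMatrix N k ^ R) μ ν * C (modularS (N + 1) k ν s) =
      eigenNum s ^ R * C (modularS (N + 1) k μ s) := by
  induction R generalizing μ with
  | zero => simp [Matrix.one_apply]
  | succ R ih =>
    have : ∑ ν, (rowMatrix N k ^ (R + 1)) μ ν * C (modularS (N + 1) k ν s) =
        ∑ κ, rowMatrix N k μ κ *
          ∑ ν, (rowMatrix N k ^ R) κ ν * C (modularS (N + 1) k ν s) := by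
      simp only [pow_succ' (rowMatrix N k), Matrix.mul_apply, Finset.sum_mul, Finset.mul_sum,
        mul_assoc]
      exact Finset.sum_comm
    rw [this, pow_succ, mul_right_comm, Finset.mul_sum]
    simp only [mul_left_comm (eigenDen s ^ R), ih]
    simp only [mul_left_comm _ (eigenNum s ^ R)]
    rw [← Finset.mul_sum, mul_assoc, mul_comm _ (eigenDen s), eigenDen_mul_sum, pow_succ, mul_assoc]

theorem eigenDen_natDegree_le (s : DominantWeight (N + 1) k) :
    (eigenDen s).natDegree ≤ N + 1 := by
  refine (natDegree_prod_le _ _).trans ?_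
  refine (Finset.sum_le_card_nsmul _ _ 1 fun i _ => ?_).trans (by simp)
  refine (natDegree_sub_le _ _).trans ?_
  simp only [natDegree_one, zero_le, sup_of_le_right]
  exact (natDegree_mul_C_le _ _).trans natDegree_X_le

/-- For `k > 0` the numerators are `1` up to terms of degree `k + n > n`, whereas the denominators
have degree at most `n`; so the denominators agree, and their roots are the inverse torus points.
For `k = 0` the degrees collide, but there is only one weight. -/
theorem eigenvalue_injective {s t : DominantWeight (N + 1) k}
    (h : eigenNum s * eigenDen t = eigenNum t * eigenDen s) : s = t := by
  rcases Nat.eq_zero_or_pos k with rfl | hk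
  · apply dynkin_injective
    funext j
    have h1 := Finset.sum_eq_zero_iff.1 s.sum_dynkin j (Finset.mem_univ _)
    have h2 := Finset.sum_eq_zero_iff.1 t.sum_dynkin j (Finset.mem_univ _)
    rw [h1, h2]
  have hcoeff (a b : DominantWeight (N + 1) k) (m : ℕ) (hm : m ≤ N + 1) :
      (eigenNum a * eigenDen b).coeff m = (eigenDen b).coeff m := by
    rw [eigenNum, sub_mul, one_mul, mul_assoc, coeff_sub, coeff_C_mul, coeff_X_pow_mul',
      if_neg (by omega)]
    simp
  have hden : eigenDen s = eigenDen t := by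
    ext m
    rcases le_or_gt m (N + 1) with hm | hm
    · rw [← hcoeff t s m hm, ← h, hcoeff s t m hm]
    · rw [coeff_eq_zero_of_natDegree_lt ((eigenDen_natDegree_le s).trans_lt hm),
        coeff_eq_zero_of_natDegree_lt ((eigenDen_natDegree_le t).trans_lt hm)]
  apply eq_of_torusPoint
  intro i
  have hi : s.torusPoint i ≠ 0 := phase_ne_zero _ _
  have h0 : (eigenDen s).eval (s.torusPoint i)⁻¹ = 0 := by
    rw [eigenDen, eval_prod]
    exact Finset.prod_eq_zero (Finset.mem_univ i) (by simp [hi])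
  rw [hden, eigenDen, eval_prod, Finset.prod_eq_zero_iff] at h0
  obtain ⟨j, _, hj⟩ := h0
  refine ⟨j, ?_⟩
  simp only [eval_sub, eval_one, eval_mul, eval_X, eval_C] at hj
  field_simp at hj
  linear_combination hj

/-- Over the field of rational functions the columns are eigenvectors of `rowMatrix` for distinct
eigenvalues, nonzero by their vacuum entry, hence linearly independent. No orthogonality relation
enters. -/
theorem isUnit_modularS_det (hn : 2 ≤ N + 1) : IsUnit (modularS (N + 1) k).det := by
  let F := FractionRing ℂ[X]
  let φ : ℂ[X] →+* F := algebraMap ℂ[X] F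
  have hφ : Function.Injective φ := IsFractionRing.injective ℂ[X] F
  let v : DominantWeight (N + 1) k → DominantWeight (N + 1) k → F :=
    fun s μ => φ (C (modularS (N + 1) k μ s))
  let θ : DominantWeight (N + 1) k → F := fun s => φ (eigenNum s) / φ (eigenDen s)
  have hden (s : DominantWeight (N + 1) k) : φ (eigenDen s) ≠ 0 :=
    fun h => eigenDen_ne_zero s (hφ (by rw [h, map_zero]))
  have hθ : Function.Injective θ := by
    intro s t h
    rw [div_eq_div_iff (hden s) (hden t), ← map_mul, ← map_mul] at h
    exact eigenvalue_injective (hφ h)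
  have hli : LinearIndependent F v := by
    refine Module.End.eigenvectors_linearIndependent'
      (Matrix.toLin' ((rowMatrix N k).map φ)) θ hθ v fun s => ⟨?_, ?_⟩
    · rw [Module.End.mem_eigenspace_iff]
      funext μ
      have h := congrArg φ (eigenDen_mul_sum μ s)
      rw [map_mul, map_mul, map_sum] at h
      simp only [map_mul] at h
      simp only [Matrix.toLin'_apply, Matrix.mulVec, dotProduct, Matrix.map_apply, Pi.smul_apply,
        smul_eq_mul, v, θ]
      rw [div_mul_eq_mul_div, eq_div_iff (hden s), mul_comm, h]
    · intro h
      have h1 : φ (C (modularS (N + 1) k (vacuum hn k) s)) = 0 := congrFun h (vacuum hn k)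
      rw [map_eq_zero_iff φ hφ, C_eq_zero] at h1
      exact modularS_vacuum_ne_zero hn s h1
  have h1 : IsUnit (Matrix.of v) := Matrix.linearIndependent_rows_iff_isUnit.1 hli
  have h2 : (φ.comp C).mapMatrix (modularS (N + 1) k).transpose = Matrix.of v := rfl
  rw [Matrix.isUnit_iff_isUnit_det, ← h2, ← RingHom.map_det, Matrix.det_transpose] at h1
  rw [isUnit_iff_ne_zero] at h1 ⊢
  intro h
  rw [h, map_zero] at h1
  exact h1 rfl

end DominantWeight

/-! ### Gelfand–Tsetlin patterns and the hook-content product -/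

/-- The number of Gelfand–Tsetlin patterns whose top row is `q` (weakly increasing), as a
determinant of binomial coefficients. -/
def patternDet {R : ℕ} (q : Fin R → ℕ) : ℤ :=
  (Matrix.of fun i j : Fin R => (Nat.choose (q i + i) j : ℤ)).det

theorem sum_Icc_choose_add {a b : ℕ} (h : a ≤ b) (i j : ℕ) :
    ∑ m ∈ Finset.Icc a b, ((m + i).choose j : ℤ) =
      ((b + i + 1).choose (j + 1) : ℤ) - (a + i).choose (j + 1) := by
  induction b, h using Nat.le_induction with
  | base => rw [Finset.Icc_self, Finset.sum_singleton, Nat.choose_succ_succ]; push_cast; ring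
  | succ b hb ih =>
    rw [← Finset.insert_Icc_right_eq_Icc_add_one (by omega), Finset.sum_insert (by simp), ih,
      show b + 1 + i = b + i + 1 by ring, Nat.choose_succ_succ (b + i + 1) j]
    push_cast
    ring

/-- The branching rule: summing over all rows interlacing with `q`. -/
theorem sum_patternDet {R : ℕ} (q : Fin (R + 1) → ℕ) (hq : Monotone q) :
    ∑ p ∈ Fintype.piFinset fun i : Fin R => Finset.Icc (q i.castSucc) (q i.succ), patternDet p =
      patternDet q := by
  set A : Matrix (Fin (R + 1)) (Fin (R + 1)) ℤ :=
    Matrix.of fun i j => (Nat.choose (q i + i) j : ℤ) with hA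
  -- Differences of consecutive rows reduce the first column of ones to a unit vector. After Laplace
  -- expansion the remaining entries are sums of binomials over the interlacing intervals, by
  -- `sum_Icc_choose_add`.
  set B : Matrix (Fin (R + 1)) (Fin (R + 1)) ℤ := Matrix.of fun i j =>
    (Fin.cases (A 0 j) (fun i => A i.succ j - A i.castSucc j) i : ℤ) with hB
  have h1 : A.det = B.det := by
    apply Matrix.det_eq_of_forall_row_eq_smul_add_pred (fun _ => 1)
    · intro j; simp [hB]
    · intro i j; simp [hB]
  have hB0 : B 0 0 = 1 := by simp [hB, hA]
  have hBs (i : Fin R) : B i.succ 0 = 0 := by simp [hB, hA]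
  have h2 := (Matrix.detRowAlternating (n := Fin R) (R := ℤ)).toMultilinearMap.map_sum_finset
      (fun i m j => ((m + i.val).choose j : ℤ)) (fun i => Finset.Icc (q i.castSucc) (q i.succ))
  have h3 : patternDet q = A.det := rfl
  rw [h3, h1, Matrix.det_succ_column_zero, Fin.sum_univ_succ]
  simp only [hBs, hB0, mul_zero, zero_mul, Finset.sum_const_zero, add_zero, Fin.val_zero, pow_zero,
    one_mul]
  refine Eq.trans h2.symm ?_
  change Matrix.det _ = _
  congr 1
  ext i j
  rw [Finset.sum_apply, sum_Icc_choose_add (hq (Fin.castSucc_le_succ i))]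
  simp [hA, hB, add_assoc]

/-- `j!` times the binomial `(q i + i).choose j` is a falling factorial, monic of degree `j` in `q i
+ i`; so scaling the columns gives a Vandermonde determinant. -/
theorem prod_factorial_mul_patternDet {R : ℕ} (q : Fin R → ℕ) :
    (∏ i : Fin R, (Nat.factorial i : ℤ)) * patternDet q =
      ∏ i : Fin R, ∏ j ∈ Finset.Ioi i, ((q j + j : ℤ) - (q i + i)) := by
  have h := Matrix.det_eval_matrixOfPolynomials_eq_det_vandermonde
      (fun i : Fin R => ((q i + i : ℕ) : ℤ)) (fun i => descPochhammer ℤ i)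
      (fun i => descPochhammer_natDegree ℤ i) (fun i => monic_descPochhammer ℤ i)
  rw [Matrix.det_vandermonde] at h
  push_cast at h
  rw [h, patternDet, ← Matrix.det_mul_row]
  congr 1
  ext i j
  simp only [Matrix.of_apply]
  rw [← Nat.cast_add, descPochhammer_eval_eq_descFactorial ℤ,
    Nat.descFactorial_eq_factorial_mul_choose]
  push_cast
  rfl

namespace YoungDiagram

theorem hookLength_pos {Y : YoungDiagram} {i j : ℕ} (h : (i, j) ∈ Y) : 0 < hookLength Y (i, j) := by
  have h1 := mem_iff_lt_rowLen.1 h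
  have h2 := mem_iff_lt_colLen.1 h
  simp only [hookLength]
  omega

/-- The hooks of a row, together with the differences of the shifted row length with those of the
lower rows, exhaust an initial segment. -/
theorem prod_hookLength_row (Y : YoungDiagram) {N i : ℕ} (hi : i < N) (hN : Y.colLen 0 ≤ N) :
    (∏ j ∈ Finset.range (Y.rowLen i), hookLength Y (i, j)) *
      ∏ r ∈ Finset.Ioo i N, ((Y.rowLen i - i : ℤ) - (Y.rowLen r - r)) =
      (Nat.factorial (Y.rowLen i + (N - 1 - i)) : ℤ) := by
  set L := Y.rowLen i + (N - 1 - i) with hL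
  let f : ℕ ⊕ ℕ → ℤ := Sum.elim (fun j => hookLength Y (i, j))
    (fun r => (Y.rowLen i - i : ℤ) - (Y.rowLen r - r))
  have hcol {r j : ℕ} : r < Y.colLen j ↔ j < Y.rowLen r := by
    rw [← mem_iff_lt_colLen, mem_iff_lt_rowLen]
  have hinj : Set.InjOn f ((Finset.range (Y.rowLen i)).disjSum (Finset.Ioo i N)) := by
    -- Equality would mean `colLen j - r = j + 1 - rowLen r`, but by `hcol` exactly one of these two
    -- numbers is positive.
    have key {j r : ℕ} (hr : i < r) : f (Sum.inl j) ≠ f (Sum.inr r) := by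
      simp only [f, Sum.elim_inl, Sum.elim_inr, hookLength]
      have := hcol (r := r) (j := j)
      omega
    rintro (j | r) hx (j' | r') hy h
    · simp only [f, Sum.elim_inl, hookLength] at h
      congr 1
      rcases lt_trichotomy j j' with h' | h' | h'
      · have := Y.colLen_anti _ _ h'.le; omega
      · exact h'
      · have := Y.colLen_anti _ _ h'.le; omega
    · simp at hy
      exact absurd h (key hy.1)
    · simp at hx
      exact absurd h.symm (key hx.1)
    · simp only [f, Sum.elim_inr] at h
      congr 1
      rcases lt_trichotomy r r' with h' | h' | h'
      · have := Y.rowLen_anti _ _ h'.le; omega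
      · exact h'
      · have := Y.rowLen_anti _ _ h'.le; omega
  have himg : ((Finset.range (Y.rowLen i)).disjSum (Finset.Ioo i N)).image f =
      (Finset.Ico 1 (L + 1)).image (fun m : ℕ => (m : ℤ)) := by
    apply Finset.eq_of_subset_of_card_le
    · intro z hz
      rw [Finset.mem_image] at hz ⊢
      obtain ⟨x, hx, rfl⟩ := hz
      have hb : 1 ≤ f x ∧ f x ≤ L := by
        rcases x with j | r
        · simp only [Finset.inl_mem_disjSum, Finset.mem_range] at hx
          have h1 := hookLength_pos (mem_iff_lt_rowLen.2 hx)
          have h2 := Y.colLen_anti 0 j (Nat.zero_le _)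
          refine ⟨h1, ?_⟩
          simp only [f, Sum.elim_inl, hookLength]
          omega
        · simp only [Finset.inr_mem_disjSum, Finset.mem_Ioo] at hx
          have h1 := Y.rowLen_anti _ _ hx.1.le
          simp only [f, Sum.elim_inr]
          omega
      exact ⟨(f x).toNat, by simp; omega, by omega⟩
    · rw [Finset.card_image_of_injective _ Nat.cast_injective, Finset.card_image_of_injOn hinj]
      simp [hL]
      omega
  have h1 := Finset.prod_image (f := fun z : ℤ => z) hinj
  rw [himg, Finset.prod_image (fun _ _ _ _ h => Nat.cast_injective h), Finset.prod_disjSum] at h1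
  rw [← Finset.prod_Ico_id_eq_factorial, Nat.cast_prod, h1]
  rfl

/-- Along row `i` the factors are the consecutive integers starting at `N - i`. -/
theorem prod_content_row (p N i : ℕ) (hi : i < N) :
    (∏ j ∈ Finset.range p, ((N : ℤ) + content (i, j))) * (Nat.factorial (N - 1 - i) : ℤ) =
      (Nat.factorial (p + (N - 1 - i)) : ℤ) := by
  induction p with
  | zero => simp
  | succ p ih =>
    rw [Finset.prod_range_succ, mul_right_comm, ih, show p + 1 + (N - 1 - i) =
      (p + (N - 1 - i)) + 1 by ring, Nat.factorial_succ,
      show _root_.content (i, p) = (p : ℤ) - i from rfl]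
    push_cast [Nat.cast_sub (show i ≤ N - 1 by omega), Nat.cast_sub (show 1 ≤ N by omega)]
    ring

theorem prod_cells {M : Type*} [CommMonoid M] (Y : YoungDiagram) {N : ℕ} (hN : Y.colLen 0 ≤ N)
    (f : ℕ × ℕ → M) :
    ∏ s ∈ Y.cells, f s = ∏ i ∈ Finset.range N, ∏ j ∈ Finset.range (Y.rowLen i), f (i, j) := by
  rw [Finset.prod_sigma']
  refine Finset.prod_bij' (fun s _ => ⟨s.1, s.2⟩) (fun s _ => (s.1, s.2)) ?_ ?_ ?_ ?_ ?_
  · rintro ⟨i, j⟩ h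
    have h1 : (i, j) ∈ Y := h
    have h2 := mem_iff_lt_colLen.1 h1
    have h3 := Y.colLen_anti 0 j (Nat.zero_le _)
    simp only [Finset.mem_sigma, Finset.mem_range]
    exact ⟨by omega, mem_iff_lt_rowLen.1 h1⟩
  · rintro ⟨i, j⟩ h
    simp only [Finset.mem_sigma, Finset.mem_range] at h
    exact mem_iff_lt_rowLen.2 h.2
  all_goals simp

/-- The hook-content product counts Gelfand–Tsetlin patterns. -/
theorem hookContentProd_eq_patternDet (Y : YoungDiagram) {N : ℕ} (hN : Y.colLen 0 ≤ N) :
    hookContentProd N Y = (patternDet fun i : Fin N => Y.rowLen (N - 1 - i) : ℤ) := by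
  have hF : (∏ i : Fin N, (Nat.factorial i : ℤ)) ≠ 0 :=
    Finset.prod_ne_zero_iff.2 fun i _ => by exact_mod_cast Nat.factorial_ne_zero _
  have hH : ∏ i ∈ Finset.range N, ∏ j ∈ Finset.range (Y.rowLen i), hookLength Y (i, j) ≠ 0 :=
    Finset.prod_ne_zero_iff.2 fun i _ => Finset.prod_ne_zero_iff.2 fun j hj =>
      (hookLength_pos (mem_iff_lt_rowLen.2 (Finset.mem_range.1 hj))).ne'
  have h1 : (∏ i ∈ Finset.range N, ∏ j ∈ Finset.range (Y.rowLen i), ((N : ℤ) + content (i, j))) *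
      ∏ i ∈ Finset.range N, (Nat.factorial (N - 1 - i) : ℤ) =
      (∏ i ∈ Finset.range N, ∏ j ∈ Finset.range (Y.rowLen i), hookLength Y (i, j)) *
        ∏ i ∈ Finset.range N, ∏ r ∈ Finset.Ioo i N,
          ((Y.rowLen i - i : ℤ) - (Y.rowLen r - r)) := by
    rw [← Finset.prod_mul_distrib, ← Finset.prod_mul_distrib]
    refine Finset.prod_congr rfl fun i hi => ?_
    rw [prod_content_row _ _ _ (Finset.mem_range.1 hi),
      prod_hookLength_row Y (Finset.mem_range.1 hi) hN]
  have h2 : ∏ i ∈ Finset.range N, (Nat.factorial (N - 1 - i) : ℤ) =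
      ∏ i : Fin N, (Nat.factorial i : ℤ) := by
    rw [Finset.prod_range_reflect (fun i => (Nat.factorial i : ℤ)),
      Fin.prod_univ_eq_prod_range (fun i => (Nat.factorial i : ℤ))]
  -- Reversing the rows turns the decreasing row lengths into the increasing top row that
  -- `patternDet` expects, and swaps the two indices of each pair.
  have h3 : ∏ i ∈ Finset.range N, ∏ r ∈ Finset.Ioo i N,
      ((Y.rowLen i - i : ℤ) - (Y.rowLen r - r)) =
      ∏ i : Fin N, ∏ j ∈ Finset.Ioi i,
        (((Y.rowLen (N - 1 - j) : ℕ) + j : ℤ) - ((Y.rowLen (N - 1 - i) : ℕ) + i)) := by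
    rw [Finset.prod_sigma', Finset.prod_sigma']
    refine Finset.prod_bij'
      (fun s hs => ⟨⟨N - 1 - s.2, by simp at hs; omega⟩, ⟨N - 1 - s.1, by simp at hs; omega⟩⟩)
      (fun s _ => ⟨N - 1 - s.2, N - 1 - s.1⟩) ?_ ?_ ?_ ?_ ?_
    · rintro ⟨i, r⟩ hs
      simp at hs ⊢
      omega
    · rintro ⟨i, r⟩ hs
      simp only [Finset.mem_sigma, Finset.mem_univ, Finset.mem_Ioi, true_and, Fin.lt_def,
        Finset.mem_range, Finset.mem_Ioo] at hs ⊢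
      omega
    · rintro ⟨i, r⟩ hs
      simp at hs
      simp only [Sigma.mk.injEq, heq_eq_eq]
      omega
    · rintro ⟨i, r⟩ hs
      simp only [Sigma.mk.injEq, heq_eq_eq, Fin.ext_iff]
      omega
    · rintro ⟨i, r⟩ hs
      simp at hs
      have e1 : N - 1 - (N - 1 - i) = i := by omega
      have e2 : N - 1 - (N - 1 - r) = r := by omega
      simp only [e1, e2]
      omega
  rw [h2, h3, ← prod_factorial_mul_patternDet, mul_left_comm, mul_comm] at h1
  have h4 := mul_left_cancel₀ hF h1
  rw [hookContentProd, prod_cells Y hN, ← mul_right_inj' (Int.cast_ne_zero (α := ℚ).2 hH),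
    ← Int.cast_mul, ← h4]
  push_cast
  rw [← Finset.prod_mul_distrib]
  refine Finset.prod_congr rfl fun i _ => ?_
  rw [← Finset.prod_mul_distrib]
  refine Finset.prod_congr rfl fun j hj => ?_
  have := (hookLength_pos (mem_iff_lt_rowLen.2 (Finset.mem_range.1 hj))).ne'
  have : (hookLength Y (i, j) : ℚ) ≠ 0 := by exact_mod_cast this
  field_simp

end YoungDiagram

/-! ### Vacuum matrix elements and fusion coefficients -/

namespace DominantWeight

variable {N k : ℕ}

/-- The weight with prescribed parts. -/
def ofParts (p : ℕ → ℕ) (hp : Antitone p) (h0 : p 0 ≤ k) (hN : p N = 0) :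
    DominantWeight (N + 1) k :=
  ⟨Fin.lastCases (k - p 0) fun j => p j - p (j + 1), by
    rw [Fin.sum_univ_castSucc]
    simp only [Fin.lastCases_last, Fin.lastCases_castSucc]
    have : ∑ j : Fin N, (p j - p (j + 1)) = p 0 - p N := by
      rw [Fin.sum_univ_eq_sum_range (fun j => p j - p (j + 1))]
      clear hN
      induction N with
      | zero => simp
      | succ M ih =>
        have h1 : p M ≤ p 0 := hp (Nat.zero_le M)
        have h2 : p (M + 1) ≤ p M := hp (Nat.le_succ M)
        rw [Finset.sum_range_succ, ih]
        omega
    omega⟩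

theorem part_ofParts (p : ℕ → ℕ) (hp : Antitone p) (h0 : p 0 ≤ k) (hN : p N = 0) {j : ℕ}
    (hj : j ≤ N) : (ofParts p hp h0 hN).part j = p j := by
  induction hj using Nat.decreasingInduction with
  | self => rw [part_eq_zero _ _ (by omega), hN]
  | of_succ j hj ih =>
    rw [part_eq_add _ j (by omega), ih]
    have h1 : (ofParts p hp h0 hN).dynkin (Fin.castSucc ⟨j, hj⟩) = p j - p (j + 1) := by
      simp only [dynkin, ofParts, Fin.lastCases_castSucc]
    have h2 := hp (Nat.le_succ j)
    have h3 : (ofParts p hp h0 hN).dynkin ⟨j, by omega⟩ = p j - p (j + 1) := h1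
    rw [h3]
    simp only [Nat.succ_eq_add_one] at h2
    omega

theorem part_eq_zero_of_le {n : ℕ} {l : DominantWeight n k} {i j : ℕ} (h : l.part i = 0)
    (hij : i ≤ j) : l.part j = 0 :=
  Nat.le_zero.1 ((l.part_anti hij).trans_eq h)

theorem eq_of_part_eq {l s : DominantWeight (N + 1) k} (h : ∀ j < N, l.part j = s.part j) :
    l = s := by
  have hp (j : ℕ) : l.part j = s.part j := by
    rcases lt_or_ge j N with hj | hj
    · exact h j hj
    · rw [part_eq_zero _ _ (by omega), part_eq_zero _ _ (by omega)]
  apply eq_of_shifted_eq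
  funext i
  simp only [shifted, size, hp]

/-- In a row without wrapping paths, the edge values are the differences of the parts. -/
theorem part_add_of_row {κ l : DominantWeight (N + 1) k} {c : Fin (N + 1) → ℕ}
    (hN : cycPred c (Fin.last N) = 0)
    (h : ∀ j, l.dynkin j + c j = κ.dynkin j + cycPred c j) (j : Fin (N + 1)) :
    κ.part j + cycPred c j = l.part j := by
  induction j using Fin.reverseInduction with
  | last => rw [part_eq_zero _ _ (by simp), part_eq_zero _ _ (by simp), hN]
  | cast j ih =>
    have h1 := h j.castSucc
    have h2 := κ.part_eq_add j (by omega)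
    have h3 := l.part_eq_add j (by omega)
    change κ.part j = κ.dynkin j.castSucc + _ at h2
    change l.part j = l.dynkin j.castSucc + _ at h3
    simp only [cycPred_succ, Fin.val_succ] at ih
    rw [Fin.val_castSucc]
    omega

open Classical in
/-- The rows below a weight with fewer than `N` parts: they are given by interlacing. -/
theorem sum_rowSet {κ l : DominantWeight (N + 1) k} {R : ℕ} (hR : R < N) (hκ : κ.part R = 0) :
    X ^ κ.size * rowMatrix N k κ l = if l.part (R + 1) = 0 ∧
      ∀ j, l.part (j + 1) ≤ κ.part j ∧ κ.part j ≤ l.part j then X ^ l.size else 0 := by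
  have hκ' (j : ℕ) (hj : R ≤ j) : κ.part j = 0 := part_eq_zero_of_le hκ hj
  have hd (j : Fin N) (hj : R ≤ j.val) : κ.dynkin j.castSucc = 0 := by
    have h := κ.part_eq_add j (by omega)
    change κ.part j = κ.dynkin j.castSucc + _ at h
    have := hκ' j hj
    omega
  have hparts {c : Fin (N + 1) → ℕ} (hc : c ∈ rowSet κ l) (j : Fin (N + 1)) :
      κ.part j + cycPred c j = l.part j := by
    rw [mem_rowSet] at hc
    refine part_add_of_row ?_ hc.2 j
    -- The edge entering the last column leaves site `M`, which is empty since `R ≤ M`. This is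
    -- where `R < N` is needed.
    obtain ⟨M, rfl⟩ : ∃ M, N = M + 1 := ⟨N - 1, by omega⟩
    have h1 := hc.1 (Fin.last M).castSucc
    rw [hd _ (by simp; omega)] at h1
    rw [← Fin.succ_last, cycPred_succ]
    omega
  rw [rowMatrix, Finset.mul_sum]
  split_ifs with h
  · obtain ⟨hl, hi⟩ := h
    -- By `hparts` the edges must be the increments of the parts; the edge leaving the last column
    -- feeds the first part.
    set c : Fin (N + 1) → ℕ := Fin.lastCases (l.part 0 - κ.part 0)
      (fun j => l.part (j + 1) - κ.part (j + 1)) with hc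
    have hcl : c (Fin.last N) = l.part 0 - κ.part 0 := by simp [hc]
    have hcs (j : Fin N) : c j.castSucc = l.part (j + 1) - κ.part (j + 1) := by simp [hc]
    have hmem : c ∈ rowSet κ l := by
      rw [mem_rowSet]
      constructor
      · intro j
        refine Fin.lastCases ?_ (fun j => ?_) j
        · have h1 := κ.part_zero_add
          have h2 := l.part_le 0
          omega
        · have h := κ.part_eq_add j (by omega)
          change κ.part j = κ.dynkin j.castSucc + _ at h
          have := (hi j).1
          rw [hcs]
          omega
      · have hpred (j : Fin (N + 1)) : cycPred c j = l.part j - κ.part j := by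
          refine Fin.cases ?_ (fun j => ?_) j
          · rw [cycPred_zero, hcl]; rfl
          · rw [cycPred_succ, hcs]; rfl
        intro j
        rw [hpred]
        refine Fin.lastCases ?_ (fun j => ?_) j
        · have h1 := κ.part_zero_add
          have h2 := l.part_zero_add
          have h3 := (hi 0).2
          have h4 := κ.part_eq_zero N (by omega)
          have h5 := l.part_eq_zero N (by omega)
          rw [Fin.val_last]
          omega
        · have h1 := κ.part_eq_add j (by omega)
          change κ.part j = κ.dynkin j.castSucc + _ at h1
          have h2 := l.part_eq_add j (by omega)
          change l.part j = l.dynkin j.castSucc + _ at h2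
          have h3 := (hi j).2
          have h4 := (hi (j + 1)).2
          rw [hcs, Fin.val_castSucc]
          omega
    rw [Finset.sum_eq_single c]
    · rw [← pow_add, ← sum_cycPred, size, size,
        ← Fin.sum_univ_eq_sum_range, ← Fin.sum_univ_eq_sum_range, ← Finset.sum_add_distrib]
      congr 1
      exact Finset.sum_congr rfl fun j _ => hparts hmem j
    · intro c' hc' hne
      refine absurd (funext fun j => ?_) hne
      refine Fin.lastCases ?_ (fun j => ?_) j
      · have h1 := hparts hc' 0
        have h2 := hparts hmem 0
        rw [cycPred_zero] at h1 h2
        omega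
      · have h1 := hparts hc' j.succ
        have h2 := hparts hmem j.succ
        rw [cycPred_succ] at h1 h2
        omega
    · exact fun h => absurd hmem h
  · rw [Finset.sum_eq_zero]
    intro c hc
    refine absurd ⟨?_, fun j => ⟨?_, ?_⟩⟩ h
    · have h1 := hparts hc (Fin.succ ⟨R, hR⟩)
      have h2 := (mem_rowSet.1 hc).1 (Fin.castSucc ⟨R, hR⟩)
      rw [hd _ le_rfl] at h2
      rw [cycPred_succ, Fin.val_succ, hκ' _ (by simp)] at h1
      simp only at h1
      omega
    · rcases lt_or_ge j N with hj | hj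
      · have h1 := hparts hc (Fin.succ ⟨j, hj⟩)
        have h2 := (mem_rowSet.1 hc).1 (Fin.castSucc ⟨j, hj⟩)
        have h3 := κ.part_eq_add j (by omega)
        change κ.part j = κ.dynkin (Fin.castSucc ⟨j, hj⟩) + _ at h3
        rw [cycPred_succ, Fin.val_succ] at h1
        simp only at h1
        omega
      · rw [l.part_eq_zero _ (by omega)]; omega
    · rcases lt_or_ge j (N + 1) with hj | hj
      · have h1 := hparts hc ⟨j, hj⟩
        simp only at h1
        omega
      · rw [κ.part_eq_zero _ (by omega)]; omega

open Classical in
/-- The transfer matrix elements starting from the vacuum: no path wraps around the cylinder, and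
the configurations are Gelfand–Tsetlin patterns. -/
theorem rowMatrix_pow_vacuum (hn : 2 ≤ N + 1) {R : ℕ} (hR : R ≤ N) (l : DominantWeight (N + 1) k) :
    (rowMatrix N k ^ R) (vacuum hn k) l =
      if l.part R = 0 then X ^ l.size * C ((patternDet fun i : Fin R => l.part (R - 1 - i) : ℤ) : ℂ)
      else 0 := by
  induction R generalizing l with
  | zero =>
    rw [pow_zero, Matrix.one_apply]
    have hiff : vacuum hn k = l ↔ l.part 0 = 0 := by
      constructor
      · rintro rfl; exact part_vacuum hn 0
      · intro h
        refine eq_of_part_eq fun j _ => ?_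
        rw [part_vacuum]
        exact (part_eq_zero_of_le h (Nat.zero_le j)).symm
    simp only [hiff]
    split_ifs with h
    · have : l.size = 0 := Finset.sum_eq_zero fun j _ =>
        part_eq_zero_of_le h (Nat.zero_le j)
      simp [this, patternDet]
    · rfl
  | succ R ih =>
    rw [pow_succ, Matrix.mul_apply]
    have h1 : ∀ κ : DominantWeight (N + 1) k,
        (rowMatrix N k ^ R) (vacuum hn k) κ * rowMatrix N k κ l =
        if l.part (R + 1) = 0 then
          if κ.part R = 0 ∧ ∀ j, l.part (j + 1) ≤ κ.part j ∧ κ.part j ≤ l.part j then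
          X ^ l.size * C ((patternDet fun i : Fin R => κ.part (R - 1 - i) : ℤ) : ℂ) else 0
        else 0 := by
      intro κ
      rw [ih (by omega)]
      by_cases hκ : κ.part R = 0
      · rw [if_pos hκ, mul_right_comm, sum_rowSet (by omega) hκ]
        by_cases hl : l.part (R + 1) = 0 <;> simp [hl, hκ]
      · simp [hκ]
    simp only [h1]
    by_cases hl : l.part (R + 1) = 0
    swap
    · simp [hl]
    simp only [hl, if_true]
    rw [← Finset.sum_filter, ← Finset.mul_sum, ← map_sum, ← Int.cast_sum,
      ← sum_patternDet (fun i : Fin (R + 1) => l.part (R + 1 - 1 - i))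
        (fun i j h => l.part_anti (by have := Fin.le_def.1 h; omega))]
    congr 3
    -- The weights `κ` one row higher correspond to the interlacing rows of the pattern, with the
    -- parts read backwards.
    refine Finset.sum_bij (fun κ _ (i : Fin R) => κ.part (R - 1 - i)) ?_ ?_ ?_ fun _ _ => rfl
    · intro κ hκ
      simp only [Finset.mem_filter, Finset.mem_univ, true_and] at hκ
      simp only [Fintype.mem_piFinset, Finset.mem_Icc, Fin.val_castSucc, Fin.val_succ]
      intro i
      have h2 := hκ.2 (R - 1 - i)
      have h3 : R - 1 - i + 1 = R + 1 - 1 - i := by omega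
      have h4 : R - 1 - i = R + 1 - 1 - (i + 1) := by omega
      rw [h3] at h2
      rw [← h4]
      exact h2
    · intro κ hκ κ' hκ' h
      simp only [Finset.mem_filter, Finset.mem_univ, true_and] at hκ hκ'
      refine eq_of_part_eq fun j _ => ?_
      rcases lt_or_ge j R with hj | hj
      · have h2 := congrFun h ⟨R - 1 - j, by omega⟩
        have h3 : R - 1 - (R - 1 - j) = j := by omega
        simpa only [h3] using h2
      · rw [part_eq_zero_of_le hκ.1 hj, part_eq_zero_of_le hκ'.1 hj]
    · intro p hp
      simp only [Fintype.mem_piFinset, Finset.mem_Icc, Fin.val_castSucc, Fin.val_succ] at hp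
      -- The inverse map: read `p` backwards and continue by zero. Interlacing with `l` makes this a
      -- partition with first part at most `k`.
      set q : ℕ → ℕ := fun j => if h : j < R then p ⟨R - 1 - j, by omega⟩ else 0 with hq
      have hlt {j : ℕ} (hj : j < R) : l.part (j + 1) ≤ q j ∧ q j ≤ l.part j := by
        have h2 := hp ⟨R - 1 - j, by omega⟩
        simp only [hq, dif_pos hj]
        have h3 : R + 1 - 1 - (R - 1 - j) = j + 1 := by omega
        have h4 : R + 1 - 1 - (R - 1 - j + 1) = j := by omega
        simpa only [h3, h4] using h2
      have hge {j : ℕ} (hj : R ≤ j) : q j = 0 := by simp [hq, hj]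
      have hle (j : ℕ) : l.part (j + 1) ≤ q j ∧ q j ≤ l.part j := by
        rcases lt_or_ge j R with hj | hj
        · exact hlt hj
        · rw [hge hj]
          exact ⟨(part_eq_zero_of_le hl (Nat.succ_le_succ hj)).le, Nat.zero_le _⟩
      have hanti : Antitone q := antitone_nat_of_succ_le fun j => (hle (j + 1)).2.trans (hle j).1
      have hpart (j : ℕ) : (ofParts (k := k) q hanti ((hle 0).2.trans (l.part_le 0))
          (hge (by omega : R ≤ N))).part j = q j := by
        rcases le_or_gt j N with hj | hj
        · exact part_ofParts _ _ _ _ hj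
        · rw [part_eq_zero _ _ (by omega), hge (by omega : R ≤ j)]
      refine ⟨ofParts q hanti ((hle 0).2.trans (l.part_le 0)) (hge (by omega)), ?_, ?_⟩
      · simp only [Finset.mem_filter, Finset.mem_univ, true_and, hpart]
        exact ⟨hge le_rfl, hle⟩
      · funext i
        have h3 : R - 1 - (R - 1 - i.val) = i := by omega
        simp only [hpart]
        simp only [hq, h3]
        rw [dif_pos (by omega)]

theorem rowLen_diagram (l : DominantWeight (N + 1) k) (i : ℕ) :
    l.diagram.rowLen i = l.part i := by
  have key (j : ℕ) : j < l.diagram.rowLen i ↔ j < l.part i := by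
    rw [← YoungDiagram.mem_iff_lt_rowLen, ← YoungDiagram.mem_cells]
    simp only [diagram, Finset.mem_filter, Finset.mem_product, Finset.mem_range]
    have h1 := l.part_le i
    have h2 := l.part_eq_zero i
    omega
  exact le_antisymm (not_lt.1 fun h => lt_irrefl _ ((key _).1 h))
    (not_lt.1 fun h => lt_irrefl _ ((key _).2 h))

theorem hookContentProd_diagram (l : DominantWeight (N + 1) k) :
    hookContentProd N l.diagram = (patternDet fun i : Fin N => l.part (N - 1 - i) : ℤ) := by
  rw [YoungDiagram.hookContentProd_eq_patternDet]
  · simp only [rowLen_diagram]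
  · by_contra! h
    rw [← YoungDiagram.mem_iff_lt_colLen, YoungDiagram.mem_iff_lt_rowLen, rowLen_diagram,
      part_eq_zero _ _ (by omega)] at h
    exact lt_irrefl _ h

theorem rowMatrix_pow_vacuum_eq (hn : 2 ≤ N + 1) (l : DominantWeight (N + 1) k) :
    (rowMatrix N k ^ N) (vacuum hn k) l =
      X ^ l.size * C ((hookContentProd N l.diagram : ℚ) : ℂ) := by
  rw [rowMatrix_pow_vacuum hn le_rfl, if_pos (part_eq_zero _ _ le_rfl), hookContentProd_diagram]
  push_cast
  rfl

/-- The powers of the transfer matrix in terms of fusion coefficients. -/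
theorem rowMatrix_pow_eq_sum_fusionCoeff (hn : 2 ≤ N + 1) (μ ν : DominantWeight (N + 1) k) :
    (rowMatrix N k ^ N) μ ν = ∑ l : DominantWeight (N + 1) k,
      X ^ l.size * C (fusionCoeff hn l μ ν * ((hookContentProd N l.diagram : ℚ) : ℂ)) := by
  have hinv : modularS (N + 1) k * (modularS (N + 1) k)⁻¹ = 1 := Matrix.mul_nonsing_inv _ (isUnit_modularS_det hn)
  have hsymm : ((modularS (N + 1) k)⁻¹).transpose = (modularS (N + 1) k)⁻¹ := by
    rw [Matrix.transpose_nonsing_inv, modularS_transpose]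
  have h1 (s : DominantWeight (N + 1) k) :
      ∑ κ, (rowMatrix N k ^ N) μ κ * C (modularS (N + 1) k κ s) = ∑ l : DominantWeight (N + 1) k,
        X ^ l.size * C (((hookContentProd N l.diagram : ℚ) : ℂ) *
          (modularS (N + 1) k l s * modularS (N + 1) k μ s / modularS (N + 1) k (vacuum hn k) s)) := by
    have hv := modularS_vacuum_ne_zero hn s
    -- The eigenvalue enters the row of `μ` and the vacuum row alike. Eliminating it between `e1`
    -- and `e2` expresses the former through the explicit vacuum row.
    have e1 := eigenDen_mul_rowMatrix_pow N μ s
    have e2 := eigenDen_mul_rowMatrix_pow N (vacuum hn k) s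
    simp only [rowMatrix_pow_vacuum_eq] at e2
    refine mul_left_cancel₀ (mul_ne_zero (pow_ne_zero N (eigenDen_ne_zero s)) (C_ne_zero.2 hv)) ?_
    have e3 : C (modularS (N + 1) k (vacuum hn k) s) * ∑ l : DominantWeight (N + 1) k,
        X ^ l.size * C (((hookContentProd N l.diagram : ℚ) : ℂ) *
          (modularS (N + 1) k l s * modularS (N + 1) k μ s / modularS (N + 1) k (vacuum hn k) s)) =
        C (modularS (N + 1) k μ s) * ∑ l : DominantWeight (N + 1) k,
          X ^ l.size * C ((hookContentProd N l.diagram : ℚ) : ℂ) * C (modularS (N + 1) k l s) := by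
      rw [Finset.mul_sum, Finset.mul_sum]
      refine Finset.sum_congr rfl fun l _ => ?_
      rw [mul_left_comm, mul_assoc, mul_left_comm (C (modularS (N + 1) k μ s)), ← C_mul, ← C_mul, ← C_mul]
      congr 2
      field_simp
    linear_combination C (modularS (N + 1) k (vacuum hn k) s) * e1 - eigenDen s ^ N * e3 -
      C (modularS (N + 1) k μ s) * e2
  -- Inserting `S * S⁻¹ = 1` recovers the matrix entry. Symmetry of `S⁻¹` then matches the index
  -- order of the Verlinde formula.
  have h2 : (rowMatrix N k ^ N) μ ν =
      ∑ s, (∑ κ, (rowMatrix N k ^ N) μ κ * C (modularS (N + 1) k κ s)) * C ((modularS (N + 1) k)⁻¹ s ν) := by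
    simp only [Finset.sum_mul, mul_assoc, ← C_mul]
    rw [Finset.sum_comm]
    simp only [← Finset.mul_sum, ← map_sum, ← Matrix.mul_apply, hinv, Matrix.one_apply]
    simp
  rw [h2]
  simp only [h1, Finset.sum_mul]
  rw [Finset.sum_comm]
  refine Finset.sum_congr rfl fun l _ => ?_
  simp only [mul_assoc, ← C_mul, ← Finset.mul_sum, ← map_sum]
  congr 2
  rw [fusionCoeff, mul_comm]
  congr 1
  refine Finset.sum_congr rfl fun s _ => ?_
  have : (modularS (N + 1) k)⁻¹ s ν = (modularS (N + 1) k)⁻¹ ν s := congrFun (congrFun hsymm ν) s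
  rw [this]
  ring

/-! ### Lattice configurations and the count of outer edges -/

/-- The lattice configurations on a cylinder with `R` rows: pairs consisting of the values of the
horizontal and of the vertical edges. -/
def rowConfigs (R : ℕ) (μ ν : DominantWeight (N + 1) k) :
    Set ((Fin R → Fin (N + 1 + 1) → ℕ) × (Fin (R + 1) → Fin (N + 1) → ℕ)) :=
  {C | (∀ i j, VertexAllowed (C.1 i j.castSucc) (C.2 i.castSucc j) (C.1 i j.succ) (C.2 i.succ j)) ∧
    (∀ i, C.1 i 0 = C.1 i (Fin.last (N + 1))) ∧
    C.2 0 = μ.dynkin ∧ C.2 (Fin.last R) = ν.dynkin}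

/-- Placing a row on top of a configuration. -/
def addRow {R : ℕ} (a : Fin (N + 1) → ℕ) (c : Fin (N + 1) → ℕ)
    (C : (Fin R → Fin (N + 1 + 1) → ℕ) × (Fin (R + 1) → Fin (N + 1) → ℕ)) :
    (Fin (R + 1) → Fin (N + 1 + 1) → ℕ) × (Fin (R + 1 + 1) → Fin (N + 1) → ℕ) :=
  (Fin.cons (Fin.cons (c (Fin.last N)) c) C.1, Fin.cons a C.2)

theorem cons_last_castSucc (c : Fin (N + 1) → ℕ) (j : Fin (N + 1)) :
    (Fin.cons (c (Fin.last N)) c : Fin (N + 1 + 1) → ℕ) j.castSucc = cycPred c j := by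
  refine Fin.cases ?_ (fun j => ?_) j
  · simp
  · rw [← Fin.succ_castSucc, Fin.cons_succ, cycPred_succ]

theorem mem_rowConfigs_succ {R : ℕ} {μ ν : DominantWeight (N + 1) k}
    {C : (Fin (R + 1) → Fin (N + 1 + 1) → ℕ) × (Fin (R + 1 + 1) → Fin (N + 1) → ℕ)} :
    C ∈ rowConfigs (R + 1) μ ν ↔ ∃ κ : DominantWeight (N + 1) k, ∃ c ∈ rowSet μ κ,
      ∃ C' ∈ rowConfigs R κ ν, addRow μ.dynkin c C' = C := by
  constructor
  · rintro ⟨h1, h2, h3, h4⟩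
    set c : Fin (N + 1) → ℕ := fun j => C.1 0 j.succ with hc
    have hc0 : C.1 0 = Fin.cons (c (Fin.last N)) c := by
      funext j
      refine Fin.cases ?_ (fun j => ?_) j
      · rw [h2]; simp [hc]
      · simp [hc]
    have hrow (j : Fin (N + 1)) := h1 0 j
    simp only [hc0, cons_last_castSucc, Fin.cons_succ, VertexAllowed, Fin.castSucc_zero, h3] at hrow
    have hle : ∀ j, c j ≤ μ.dynkin j := fun j => (hrow j).2
    -- The labels below the first row are again of level `k`, since particles are conserved on the
    -- cylinder.
    have hκ : C.2 (Fin.succ 0) = (hop μ c hle).dynkin := by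
      funext j
      have e := (eq_hop_iff hle).1 rfl j
      have e' := (hrow j).1
      omega
    refine ⟨hop μ c hle, c, mem_rowSet.2 ⟨hle, (eq_hop_iff hle).1 rfl⟩,
      (fun i => C.1 i.succ, fun i => C.2 i.succ), ⟨fun i j => ?_, fun i => h2 _, hκ, ?_⟩, ?_⟩
    · exact h1 i.succ j
    · exact h4
    · refine Prod.ext ?_ ?_
      · funext i
        refine Fin.cases ?_ (fun i => rfl) i
        exact hc0.symm
      · funext i
        refine Fin.cases ?_ (fun i => rfl) i
        exact h3.symm
  · rintro ⟨κ, c, hc, C', ⟨h1, h2, h3, h4⟩, rfl⟩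
    rw [mem_rowSet] at hc
    refine ⟨fun i j => ?_, fun i => ?_, rfl, ?_⟩
    · refine Fin.cases ?_ (fun i => ?_) i
      · simp only [addRow, Fin.cons_zero, cons_last_castSucc, Fin.cons_succ, Fin.castSucc_zero,
          VertexAllowed, h3]
        have := hc.2 j
        exact ⟨by omega, hc.1 j⟩
      · simp only [addRow, Fin.cons_succ, ← Fin.succ_castSucc]
        exact h1 i j
    · refine Fin.cases ?_ (fun i => ?_) i
      · simp only [addRow, Fin.cons_zero]
        rw [← Fin.succ_last, Fin.cons_succ]
      · exact h2 i
    · simp only [addRow, ← Fin.succ_last, Fin.cons_succ]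
      exact h4

/-- The generating function of the lattice configurations is a matrix element of a power of the
row-to-row transfer matrix. -/
theorem exists_finset_rowConfigs (R : ℕ) (μ ν : DominantWeight (N + 1) k) :
    ∃ F : Finset ((Fin R → Fin (N + 1 + 1) → ℕ) × (Fin (R + 1) → Fin (N + 1) → ℕ)),
      (F : Set _) = rowConfigs R μ ν ∧
      ∑ C ∈ F, (X : ℂ[X]) ^ (∑ i, ∑ j : Fin (N + 1), C.1 i j.succ) = (rowMatrix N k ^ R) μ ν := by
  classical
  induction R generalizing μ with
  | zero =>
    by_cases h : μ = ν
    · subst h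
      refine ⟨{(Fin.elim0, fun _ => μ.dynkin)}, ?_, by simp⟩
      ext C
      simp only [Finset.coe_singleton, Set.mem_singleton_iff, rowConfigs, Set.mem_ofPred_eq]
      constructor
      · rintro rfl
        exact ⟨fun i => i.elim0, fun i => i.elim0, rfl, rfl⟩
      · rintro ⟨-, -, h, -⟩
        refine Prod.ext (funext fun i => i.elim0) (funext fun i => ?_)
        rw [Fin.fin_one_eq_zero i]
        exact h
    · refine ⟨∅, ?_, by simp [h]⟩
      ext C
      simp only [Finset.coe_empty, Set.mem_empty_iff_false, false_iff]
      rintro ⟨-, -, h1, h2⟩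
      exact h (dynkin_injective (h1.symm.trans h2))
  | succ R ih =>
    choose F hF hsum using ih
    have hF' (κ : DominantWeight (N + 1) k) (C) : C ∈ F κ ↔ C ∈ rowConfigs R κ ν := by
      rw [← hF, Finset.mem_coe]
    set G := Finset.univ.sigma fun κ : DominantWeight (N + 1) k => rowSet μ κ ×ˢ F κ with hG
    -- `addRow` forgets the intermediate weight `κ`, but the top vertical edges of the lower
    -- configuration determine it.
    have hinj : Set.InjOn (fun s : (Σ _ : DominantWeight (N + 1) k, (Fin (N + 1) → ℕ) ×
        ((Fin R → Fin (N + 1 + 1) → ℕ) × (Fin (R + 1) → Fin (N + 1) → ℕ))) =>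
        addRow μ.dynkin s.2.1 s.2.2) G := by
      rintro ⟨κ, c, C⟩ h ⟨κ', c', C'⟩ h' e
      simp only [hG, Finset.coe_sigma, Set.mem_sigma_iff, Finset.mem_coe, Finset.mem_product,
        hF'] at h h'
      simp only [addRow, Prod.mk.injEq, Fin.cons_inj] at e
      obtain ⟨⟨⟨-, rfl⟩, h1⟩, -, h2⟩ := e
      obtain rfl : C = C' := Prod.ext h1 h2
      obtain rfl : κ = κ' := dynkin_injective (h.2.2.2.2.1.symm.trans h'.2.2.2.2.1)
      rfl
    refine ⟨G.image fun s => addRow μ.dynkin s.2.1 s.2.2, ?_, ?_⟩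
    · ext C
      rw [mem_rowConfigs_succ]
      simp only [hG, Finset.coe_image, Set.mem_image, Finset.mem_coe, Finset.mem_sigma,
        Finset.mem_univ, true_and, Finset.mem_product, hF']
      constructor
      · rintro ⟨⟨κ, c, C'⟩, ⟨h1, h2⟩, h3⟩
        exact ⟨κ, c, h1, C', h2, h3⟩
      · rintro ⟨κ, c, h1, C', h2, h3⟩
        exact ⟨⟨κ, c, C'⟩, ⟨h1, h2⟩, h3⟩
    · rw [Finset.sum_image hinj, hG, Finset.sum_sigma, pow_succ', Matrix.mul_apply]
      refine Finset.sum_congr rfl fun κ _ => ?_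
      rw [← hsum, rowMatrix, Finset.sum_product, Finset.sum_mul_sum]
      refine Finset.sum_congr rfl fun c _ => Finset.sum_congr rfl fun C _ => ?_
      rw [← pow_add]
      congr 1
      rw [Fin.sum_univ_succ]
      simp [addRow]

/-- The statistic `∑ (n - j) m_j` of Dynkin labels. -/
def colabelSum (m : Fin (N + 1) → ℕ) : ℕ := ∑ j : Fin (N + 1), (N - j) * m j

/-- Counting labels from `1`, a non-affine `m_j` occurs in the first `j` parts and so complements
its weight `n - j` to `n`; the affine label contributes nothing to either side. -/
theorem colabelSum_add_size (l : DominantWeight (N + 1) k) :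
    colabelSum l.dynkin + l.size = (N + 1) * l.part 0 := by
  simp only [colabelSum, size, part, Finset.sum_filter]
  rw [Finset.sum_comm, ← Finset.sum_add_distrib, Finset.mul_sum]
  refine Finset.sum_congr rfl fun j _ => ?_
  rw [← Finset.sum_filter, Finset.sum_const]
  by_cases hj : j.val < N
  · have : (Finset.range (N + 1)).filter (fun i => i ≤ j.val ∧ j.val + 1 < N + 1) =
        Finset.range (j + 1) := by
      ext i; simp only [Finset.mem_filter, Finset.mem_range]; omega
    rw [this, Finset.card_range, if_pos (by omega), smul_eq_mul, ← add_mul]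
    congr 1
    omega
  · have : (Finset.range (N + 1)).filter (fun i => i ≤ j.val ∧ j.val + 1 < N + 1) = ∅ :=
      Finset.filter_false_of_mem fun i _ h => hj (by omega)
    rw [this, if_neg (by omega)]
    simp
    omega

/-- Each step of a particle to the right lowers the statistic by one, but a step across the seam
also raises it by `n`. -/
theorem colabelSum_of_row {h : Fin (N + 1 + 1) → ℕ} {a b : Fin (N + 1) → ℕ}
    (hr : ∀ j, VertexAllowed (h j.castSucc) (a j) (h j.succ) (b j))
    (h0 : h 0 = h (Fin.last (N + 1))) :
    (N + 1) * h 0 + colabelSum a = colabelSum b + ∑ j : Fin (N + 1), h j.succ := by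
  have h1 : colabelSum b + ∑ j : Fin (N + 1), (N - j) * h j.succ =
      colabelSum a + ∑ j : Fin (N + 1), (N - j) * h j.castSucc := by
    simp only [colabelSum, ← Finset.sum_add_distrib, ← mul_add]
    refine Finset.sum_congr rfl fun j _ => ?_
    have := (hr j).1
    congr 1
    omega
  have h2 : (N + 1) * h 0 + ∑ j : Fin (N + 1), (N - j) * h j.succ =
      ∑ j : Fin (N + 1), (N - j) * h j.castSucc + ∑ j : Fin (N + 1), h j.castSucc := by
    -- Summation by parts: the same weighted sum over all `n + 1` edges, split off at either end.
    have e1 := Fin.sum_univ_succ fun i : Fin (N + 1 + 1) => (N + 1 - i) * h i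
    have e2 := Fin.sum_univ_castSucc fun i : Fin (N + 1 + 1) => (N + 1 - i) * h i
    rw [e1] at e2
    simp only [Fin.val_zero, Fin.val_succ, Fin.val_castSucc, Fin.val_last, Nat.sub_self, zero_mul,
      add_zero, Nat.sub_zero, Nat.add_sub_add_right] at e2
    rw [e2, ← Finset.sum_add_distrib]
    refine Finset.sum_congr rfl fun j _ => ?_
    rw [Nat.sub_add_comm (Nat.lt_succ_iff.1 j.2)]
    ring
  have h3 : ∑ j : Fin (N + 1), h j.castSucc = ∑ j : Fin (N + 1), h j.succ := by
    have e1 := Fin.sum_univ_succ h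
    have e2 := Fin.sum_univ_castSucc h
    omega
  omega

theorem colabelSum_of_mem_rowConfigs {R : ℕ} {μ ν : DominantWeight (N + 1) k}
    {C : (Fin R → Fin (N + 1 + 1) → ℕ) × (Fin (R + 1) → Fin (N + 1) → ℕ)}
    (hC : C ∈ rowConfigs R μ ν) :
    (N + 1) * ∑ i, C.1 i 0 + colabelSum μ.dynkin =
      colabelSum ν.dynkin + ∑ i, ∑ j : Fin (N + 1), C.1 i j.succ := by
  obtain ⟨h1, h2, h3, h4⟩ := hC
  have h5 : ∑ i, ((N + 1) * C.1 i 0 + colabelSum (C.2 i.castSucc)) =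
      ∑ i, (colabelSum (C.2 i.succ) + ∑ j : Fin (N + 1), C.1 i j.succ) :=
    Finset.sum_congr rfl fun i _ => colabelSum_of_row (h1 i) (h2 i)
  rw [Finset.sum_add_distrib, Finset.sum_add_distrib, ← Finset.mul_sum] at h5
  have e1 := Fin.sum_univ_succ fun i => colabelSum (C.2 i)
  have e2 := Fin.sum_univ_castSucc fun i => colabelSum (C.2 i)
  rw [h3] at e1
  rw [h4] at e2
  omega

/-- Clearing the denominator and eliminating `|μ|` and `|ν|` by `colabelSum_add_size` gives the
conservation law of `colabelSum_of_mem_rowConfigs`, with `|λ|` in the place of the number of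
horizontal edges. -/
theorem degree_condition_iff (l μ ν : DominantWeight (N + 1) k) (d : ℕ) :
    (d : ℚ) = ((l.size : ℚ) + μ.size - ν.size) / (N + 1 : ℕ) + ν.part 0 - μ.part 0 ↔
      colabelSum ν.dynkin + l.size = (N + 1) * d + colabelSum μ.dynkin := by
  have hμ : (colabelSum μ.dynkin : ℚ) + μ.size = (N + 1) * μ.part 0 := by
    exact_mod_cast colabelSum_add_size μ
  have hν : (colabelSum ν.dynkin : ℚ) + ν.size = (N + 1) * ν.part 0 := by
    exact_mod_cast colabelSum_add_size ν
  rw [← @Nat.cast_inj ℚ]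
  push_cast
  have hN : (N : ℚ) + 1 ≠ 0 := by positivity
  rw [← mul_right_inj' hN]
  have : ((N : ℚ) + 1) * (((l.size : ℚ) + μ.size - ν.size) / (N + 1) + ν.part 0 - μ.part 0) =
      l.size + μ.size - ν.size + (N + 1) * ν.part 0 - (N + 1) * μ.part 0 := by
    field_simp
  rw [this]
  constructor <;> intro h <;> linarith

/-- By the conservation law, prescribing the outer edges amounts to prescribing the total over all
horizontal edges, which is the exponent of `X`. The factor `2` arises since each outer value occurs
on both sides. -/
theorem latticeConfigsWithOuter_eq_image (μ ν : DominantWeight (N + 1) k) (d : ℕ) :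
    latticeConfigsWithOuter μ ν d =
      (fun C : (Fin N → Fin (N + 1 + 1) → ℕ) × (Fin (N + 1) → Fin (N + 1) → ℕ) =>
        (⟨C.1, C.2⟩ : EdgeLabelling (N + 1))) ''
      {C ∈ rowConfigs N μ ν | colabelSum ν.dynkin + ∑ i, ∑ j : Fin (N + 1), C.1 i j.succ =
        (N + 1) * d + colabelSum μ.dynkin} := by
  have key {C : (Fin N → Fin (N + 1 + 1) → ℕ) × (Fin (N + 1) → Fin (N + 1) → ℕ)}
      (hC : C ∈ rowConfigs N μ ν) : (⟨C.1, C.2⟩ : EdgeLabelling (N + 1)).outer = 2 * d ↔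
      colabelSum ν.dynkin + ∑ i, ∑ j : Fin (N + 1), C.1 i j.succ =
        (N + 1) * d + colabelSum μ.dynkin := by
    rw [← colabelSum_of_mem_rowConfigs hC, Nat.add_right_cancel_iff,
      Nat.mul_right_inj (Nat.succ_ne_zero N)]
    have : (⟨C.1, C.2⟩ : EdgeLabelling (N + 1)).outer = 2 * ∑ i, C.1 i 0 := by
      rw [Finset.mul_sum]
      refine Finset.sum_congr rfl fun i _ => ?_
      have := hC.2.1 i
      change C.1 i 0 + C.1 i (Fin.last (N + 1)) = _
      omega
    rw [this]
    omega
  ext ⟨hor, ver⟩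
  constructor
  · rintro ⟨h1, h2⟩
    have h3 : (hor, ver) ∈ rowConfigs N μ ν := h1
    exact ⟨(hor, ver), ⟨h3, (key h3).1 h2⟩, rfl⟩
  · rintro ⟨C, ⟨h1, h2⟩, h3⟩
    rw [← h3]
    exact ⟨h1, (key h1).2 h2⟩

end DominantWeight

/-! ### Comparison of coefficients -/

/-- Comparing coefficients in an identity between generating functions. -/
theorem card_filter_add_eq {α ι : Type*} (F : Finset α) (f : α → ℕ) (G : Finset ι) (g : ι → ℕ)
    (a : ι → ℂ) (h : ∑ x ∈ F, (X : ℂ[X]) ^ f x = ∑ i ∈ G, X ^ g i * C (a i)) (p q : ℕ) :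
    ((F.filter fun x => p + f x = q).card : ℂ) = ∑ i ∈ G with p + g i = q, a i := by
  rcases le_or_gt p q with hpq | hpq
  · have h1 := congrArg (fun r => r.coeff (q - p)) h
    simp only [finsetSum_coeff, coeff_X_pow, coeff_mul_C, ite_mul, one_mul, zero_mul] at h1
    rw [← Finset.sum_filter, ← Finset.sum_filter, Finset.sum_const, nsmul_eq_mul, mul_one] at h1
    have e (m : ℕ) : p + m = q ↔ q - p = m := by omega
    simpa only [e] using h1
  · rw [Finset.filter_false_of_mem (fun x _ => by omega),
      Finset.filter_false_of_mem (fun x _ => by omega)]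
    simp

theorem corollary2 (n k : ℕ) (hn : 2 ≤ n) (μ ν : DominantWeight n k) (d : ℕ) :
    (latticeConfigsWithOuter μ ν d).Finite ∧
    ((latticeConfigsWithOuter μ ν d).ncard : ℂ) =
      ∑ l : DominantWeight n k with
          (d : ℚ) = ((l.size : ℚ) + μ.size - ν.size) / n + ν.part 0 - μ.part 0,
        DominantWeight.fusionCoeff hn l μ ν *
          ((hookContentProd ((n : ℤ) - 1) l.diagram : ℚ) : ℂ) := by
  obtain ⟨N, rfl⟩ : ∃ N, n = N + 1 := ⟨n - 1, by omega⟩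
  obtain ⟨F, hF, hsum⟩ := DominantWeight.exists_finset_rowConfigs N μ ν
  rw [DominantWeight.rowMatrix_pow_eq_sum_fusionCoeff hn] at hsum
  set P := F.filter fun C => DominantWeight.colabelSum ν.dynkin +
    ∑ i, ∑ j : Fin (N + 1), C.1 i j.succ = (N + 1) * d + DominantWeight.colabelSum μ.dynkin with hP
  have hP' : latticeConfigsWithOuter μ ν d =
      (fun C : (Fin N → Fin (N + 1 + 1) → ℕ) × (Fin (N + 1) → Fin (N + 1) → ℕ) =>
        (⟨C.1, C.2⟩ : EdgeLabelling (N + 1))) '' (P : Set _) := by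
    rw [DominantWeight.latticeConfigsWithOuter_eq_image, hP, Finset.coe_filter, ← hF]
    rfl
  have hinj : Function.Injective
      (fun C : (Fin N → Fin (N + 1 + 1) → ℕ) × (Fin (N + 1) → Fin (N + 1) → ℕ) =>
        (⟨C.1, C.2⟩ : EdgeLabelling (N + 1))) := by
    rintro ⟨a, b⟩ ⟨a', b'⟩ h
    simpa using h
  rw [hP']
  refine ⟨P.finite_toSet.image _, ?_⟩
  rw [Set.ncard_image_of_injective _ hinj, Set.ncard_coe_finset, hP,
    card_filter_add_eq F _ _ _ _ hsum]
  simp only [DominantWeight.degree_condition_iff]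
  push_cast
  simp
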